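/- Fix an integer $d\ge 1$ and a real number $\alpha>0$, and put $\beta=2/\alpha$. For $n\ge 0$ let $\mathcal P_n(d)$ be the set of partitions $\lambda=(\lambda_1\ge\dots\ge\lambda_d\ge 0)$ of $n$ with at most $d$ nonzero parts. For $\lambda\in\mathcal P_n(d)$ with conjugate partition $\lambda'$ put $$c_\lambda(\alpha)=\prod_{(i,j)\in\lambda}\bigl(\alpha(\lambda_i-j)+(\lambda'_j-i)+1\bigr),\qquad c'_\lambda(\alpha)=\prod_{(i,j)\in\lambda}\bigl(\alpha(\lambda_i-j)+(\lambda'_j-i)+\alpha\bigr),$$ where the products run over the boxes $(i,j)$, $1\le i\le d$, $1\le j\le\lambda_i$, of the Young diagram of $\lambda$. The Jack measure restricted to $\mathcal P_n(d)$ is the probability measure $$\mathbb P^{\mathrm{Jack},\alpha}_{n,d}(\lambda)=\frac{1}{C_{n,d}(\alpha)}\,\frac{1}{c_\lambda(\alpha)c'_\lambda(\alpha)},\qquad C_{n,d}(\alpha)=\sum_{\mu\in\mathcal P_n(d)}\frac{1}{c_\mu(\alpha)c'_\mu(\alpha)}.$$ The traceless Gaussian $\beta$-ensemble is the probability measure on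 $$\mathfrak H_d=\{x\in\mathbb R^d : x_1\ge\dots\ge x_d,\ x_1+\dots+x_d=0\}$$ with density $$\frac{1}{Z_d(\beta)}\,e^{-\frac{\beta}{2}\sum_{j=1}^d x_j^2}\prod_{1\le j<k\le d}(x_j-x_k)^\beta$$ with respect to $dx_1\cdots dx_{d-1}$ (where $x_d=-(x_1+\dots+x_{d-1})$), $Z_d(\beta)$ being the normalizing constant; for $d=1$ it is the point mass at $0$. Then both of these are indeed probability measures, and if, for each $n$, $\lambda^{(n)}=(\lambda^{(n)}_1,\dots,\lambda^{(n)}_d)$ is a random element of $\mathcal P_n(d)$ with distribution $\mathbb P^{\mathrm{Jack},\alpha}_{n,d}$, and $(x_1,\dots,x_d)$ is a random vector distributed according to the traceless Gaussian $\beta$-ensemble, then, as $n\to\infty$, the random vectors $$\Bigl(\sqrt{\tfrac{\alpha d}{n}}\bigl(\lambda^{(n)}_i-\tfrac nd\bigr)\Bigr)_{1\le i\le d}$$ converge in (joint) distribution to $(x_1,\dots,x_d)$. -/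

import Mathlib

open MeasureTheory ProbabilityTheory Filter

noncomputable section

namespace JackMeasure

/-- The partitions of `n` with at most `d` nonzero parts, written as weakly decreasing sequences
`(l 0, …, l (d - 1))` of natural numbers with sum `n`. -/
def partitions (d n : ℕ) : Finset (Fin d → ℕ) :=
  {l ∈ Finset.piAntidiag Finset.univ n | ∀ i j : Fin d, i ≤ j → l j ≤ l i}

/-- The part with (zero-based) index `j` of the conjugate partition: the length of the
corresponding column of the Young diagram. -/
def conjPart {d : ℕ} (l : Fin d → ℕ) (j : ℕ) : ℕ :=
  (Finset.univ.filter fun k : Fin d => j < l k).card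

/-- The arm length of the box with zero-based row `i` and column `j`. -/
def arm {d : ℕ} (l : Fin d → ℕ) (i : Fin d) (j : ℕ) : ℝ :=
  (l i : ℝ) - ((j : ℝ) + 1)

/-- The leg length of the box with zero-based row `i` and column `j`. -/
def leg {d : ℕ} (l : Fin d → ℕ) (i : Fin d) (j : ℕ) : ℝ :=
  (conjPart l j : ℝ) - (((i : ℕ) : ℝ) + 1)

/-- The product `c_l(α)` of `α * arm + leg + 1` over the boxes of the Young diagram of `l`. -/
def hookLower {d : ℕ} (α : ℝ) (l : Fin d → ℕ) : ℝ :=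
  ∏ i : Fin d, ∏ j ∈ Finset.range (l i), (α * arm l i j + leg l i j + 1)

/-- The product `c'_l(α)` of `α * arm + leg + α` over the boxes of the Young diagram of `l`. -/
def hookUpper {d : ℕ} (α : ℝ) (l : Fin d → ℕ) : ℝ :=
  ∏ i : Fin d, ∏ j ∈ Finset.range (l i), (α * arm l i j + leg l i j + α)

/-- The normalizing constant of the restricted Jack measure. -/
def normConst (d : ℕ) (α : ℝ) (n : ℕ) : ℝ :=
  ∑ l ∈ partitions d n, 1 / (hookLower α l * hookUpper α l)

/-- The Jack probability of `l`, for the Jack measure restricted to partitions of `n` with at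
most `d` parts. -/
def prob (d : ℕ) (α : ℝ) (n : ℕ) (l : Fin d → ℕ) : ℝ :=
  1 / normConst d α n * (1 / (hookLower α l * hookUpper α l))

/-- The restricted Jack measure, as a measure on `Fin d → ℕ` carried by `partitions d n`. -/
def restricted (d : ℕ) (α : ℝ) (n : ℕ) : Measure (Fin d → ℕ) :=
  ∑ l ∈ partitions d n, ENNReal.ofReal (prob d α n l) • Measure.dirac l

/-- The rescaled parts `√(α d / n) (l i - n / d)`. -/
def rescale (d : ℕ) (α : ℝ) (n : ℕ) (l : Fin d → ℕ) : Fin d → ℝ :=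
  fun i => √(α * d / n) * ((l i : ℝ) - (n : ℝ) / d)

end JackMeasure

namespace TracelessGBE

/-- The point of the hyperplane `∑ i, x i = 0` of `ℝ ^ d` with given first `d - 1` coordinates;
the last coordinate is minus their sum. -/
def lift (d : ℕ) (y : Fin (d - 1) → ℝ) : Fin d → ℝ :=
  fun i => if h : (i : ℕ) < d - 1 then y ⟨i, h⟩ else -∑ k, y k

/-- The first `d - 1` coordinates of the points of the hyperplane with weakly decreasing
coordinates. -/
def chamber (d : ℕ) : Set (Fin (d - 1) → ℝ) :=
  {y | ∀ i j : Fin d, i ≤ j → lift d y j ≤ lift d y i}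

/-- The unnormalized density `exp (-β/2 ∑ x_j²) ∏_{j < k} (x_j - x_k) ^ β`. -/
def weight {d : ℕ} (β : ℝ) (x : Fin d → ℝ) : ℝ :=
  Real.exp (-(β / 2) * ∑ j, x j ^ 2) *
    ∏ j : Fin d, ∏ k ∈ Finset.univ.filter (fun k : Fin d => j < k), (x j - x k) ^ β

/-- The normalizing constant `Z_d(β)`, an integral with respect to `dx_1 ⋯ dx_{d-1}`. -/
def partitionFunction (d : ℕ) (β : ℝ) : ENNReal :=
  ∫⁻ y in chamber d, ENNReal.ofReal (weight β (lift d y))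

/-- The traceless Gaussian `β`-ensemble: the law on `ℝ ^ d`, carried by the weakly decreasing
points with coordinate sum `0`, with density `weight / Z_d(β)` with respect to
`dx_1 ⋯ dx_{d-1}`. -/
def law (d : ℕ) (β : ℝ) : Measure (Fin d → ℝ) :=
  ((volume.restrict (chamber d)).withDensity fun y =>
    (partitionFunction d β)⁻¹ * ENNReal.ofReal (weight β (lift d y))).map (lift d)

end TracelessGBE

end

/-! Cut each row of the diagram at the lengths of the rows below it. On each piece the leg is
constant, so the hook factors there multiply to a ratio of Gamma values (`prod_row_eq_Gamma`). Up to
a factor independent of `λ`, the Jack weight is therefore a product over rows of `1 / (Γ(λ_i + a_i)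
Γ(λ_i + b_i))` times a product over pairs `i < k` of a Gamma quotient in `λ_i - λ_k` that grows like
`(λ_i - λ_k) ^ (2 / α)` (`inv_hooks_eq_Gamma`, `pairTerm_eq`).

Since the parts sum to `n`, inserting `N ^ λ_i` with `N = n / d` in each row only changes the
constant, and turns each inverse Gamma value into a Poisson weight of mean `N` up to a power
correction. By Stirling such a weight tends to `exp (-x_i² / (2α))` at the rescaled point `x`. Two
of them per row give `exp (-(β/2) x_i²)`, and the pairs give `(x_i - x_k) ^ β`
(`tendsto_localWeight`).

The sum over partitions is the integral of a step function on cubes of side `√(αd/n)` in the first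
`d - 1` coordinates. Dominated convergence applies because the row factors decay exponentially at
any prescribed rate while the pair factors grow at most exponentially (`exists_localWeight_le`).
Expectations of bounded continuous functions are quotients of two such sums, so the unknown
constants cancel. -/

noncomputable section

namespace JackMeasure

open Real Topology

/-! ### Asymptotics of the Gamma function at integer shifts -/

/-- The ratio of `Γ (m + a)` to its leading asymptotics `m! (m + 1) ^ (a - 1)`. -/
def gammaRatio (a : ℝ) (m : ℕ) : ℝ :=
  Gamma (m + a) / (m.factorial * ((m : ℝ) + 1) ^ (a - 1))

lemma gammaRatio_pos {a : ℝ} (ha : 0 < a) (m : ℕ) : 0 < gammaRatio a m := by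
  have := Gamma_pos_of_pos (show (0 : ℝ) < m + a by positivity)
  unfold gammaRatio
  positivity

/-- Valid at `m = 0` too, because the power has base `m + 1` and not `m`. -/
lemma Gamma_eq_gammaRatio {a : ℝ} (m : ℕ) :
    Gamma (m + a) = gammaRatio a m * (m.factorial * ((m : ℝ) + 1) ^ (a - 1)) := by
  unfold gammaRatio
  field_simp

lemma Gamma_mul_prod_range {a : ℝ} (ha : 0 < a) (n : ℕ) :
    Gamma a * ∏ j ∈ Finset.range n, (a + j) = Gamma (n + a) := by
  induction n with
  | zero => simp
  | succ n ih =>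
    rw [Finset.prod_range_succ, ← mul_assoc, ih, mul_comm, add_comm a, ← Gamma_add_one (by positivity)]
    push_cast
    ring_nf

/-- Euler's limit formula: after an index shift the ratio is `Γ(a) / GammaSeq a n` times two
elementary factors tending to 1. -/
lemma tendsto_gammaRatio {a : ℝ} (ha : 0 < a) : Tendsto (gammaRatio a) atTop (𝓝 1) := by
  rw [← tendsto_add_atTop_iff_nat 1]
  have hG : Gamma a ≠ 0 := (Gamma_pos_of_pos ha).ne'
  have h1 : Tendsto (fun n : ℕ => Gamma a / GammaSeq a n) atTop (𝓝 1) := by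
    have h := (tendsto_const_nhds (x := Gamma a)).div (GammaSeq_tendsto_Gamma a) hG
    rwa [div_self hG] at h
  have h2 : Tendsto (fun n : ℕ => (n : ℝ) / (n + 1)) atTop (𝓝 1) := tendsto_natCast_div_add_atTop 1
  have h3 : Tendsto (fun n : ℕ => ((n : ℝ) / (n + 2)) ^ (a - 1)) atTop (𝓝 1) := by
    simpa using (tendsto_natCast_div_add_atTop (2 : ℝ)).rpow_const (p := a - 1) (by simp)
  have h := (h1.mul h2).mul h3
  simp only [mul_one] at h
  refine h.congr' ?_
  filter_upwards [eventually_gt_atTop 0] with n hn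
  have hn' : (0 : ℝ) < n := by exact_mod_cast hn
  have hp : 0 < ∏ j ∈ Finset.range (n + 1), (a + j) := Finset.prod_pos fun j _ => by positivity
  rw [gammaRatio, GammaSeq, ← Gamma_mul_prod_range ha, div_rpow (by positivity) (by positivity),
    Nat.factorial_succ, rpow_sub_one hn'.ne']
  push_cast
  rw [show (n : ℝ) + 1 + 1 = n + 2 by ring]
  have : (n : ℝ) ^ a ≠ 0 := by positivity
  have : ((n : ℝ) + 2) ^ (a - 1) ≠ 0 := by positivity
  field_simp

lemma exists_gammaRatio_bounds {a : ℝ} (ha : 0 < a) :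
    ∃ C : ℝ, 0 < C ∧ ∀ m, gammaRatio a m ≤ C ∧ (gammaRatio a m)⁻¹ ≤ C := by
  obtain ⟨C₁, h₁⟩ := (tendsto_gammaRatio ha).bddAbove_range
  obtain ⟨C₂, h₂⟩ := ((tendsto_gammaRatio ha).inv₀ one_ne_zero).bddAbove_range
  refine ⟨max 1 (max C₁ C₂), by positivity, fun m => ⟨?_, ?_⟩⟩
  · exact (h₁ ⟨m, rfl⟩).trans (by simp)
  · exact (h₂ ⟨m, rfl⟩).trans (by simp)

/-! ### Local limit theorem for Poisson weights -/

/-- The Poisson weight of parameter `N` at `m`, multiplied by `√(2πN)`. -/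
def poissonTerm (N : ℝ) (m : ℕ) : ℝ :=
  N ^ m * exp (-N) * √(2 * π * N) / m.factorial

/-- Apply `log x ≤ x - 1` at `x = √(N/m)`. At `x = N/m` it would only bound the left side by 1; the
square root leaves a perfect square in the exponent. -/
lemma pow_mul_exp_le {N : ℝ} (hN : 0 < N) {m : ℕ} (hm : 0 < m) :
    (N / m) ^ m * exp (m - N) ≤ exp (-(√m - √N) ^ 2) := by
  have hm' : (0 : ℝ) < m := by exact_mod_cast hm
  have h1 : (N / m) ^ m = exp (m * log (N / m)) := by
    rw [mul_comm, exp_mul, exp_log (by positivity), rpow_natCast]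
  rw [h1, ← exp_add, exp_le_exp]
  have h2 : log (N / m) = 2 * log (√N / √m) := by
    rw [← sqrt_div hN.le, log_sqrt (by positivity)]
    ring
  have h3 : log (√N / √m) ≤ √N / √m - 1 := log_le_sub_one_of_pos (by positivity)
  have h4 : (m : ℝ) * (√N / √m) = √N * √m := by
    nth_rw 1 [← mul_self_sqrt hm'.le]
    field_simp
  have h5 : (m : ℝ) * log (√N / √m) ≤ √N * √m - m := by
    calc _ ≤ (m : ℝ) * (√N / √m - 1) := by gcongr
      _ = _ := by rw [mul_sub, h4, mul_one]
  rw [h2]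
  nlinarith [sq_sqrt hN.le, sq_sqrt hm'.le]

lemma poissonTerm_le {N : ℝ} (hN : 0 < N) (m : ℕ) :
    poissonTerm N m ≤ √(2 * π) * √(N / (m + 1)) * exp (-(√m - √N) ^ 2) := by
  rcases Nat.eq_zero_or_pos m with rfl | hm
  · simp only [poissonTerm, pow_zero, Nat.factorial_zero, Nat.cast_one, Nat.cast_zero, zero_add,
      sqrt_zero, zero_sub, neg_sq, sq_sqrt hN.le, div_one, one_mul]
    rw [sqrt_mul (by positivity) N, mul_comm]
  have hm' : (0 : ℝ) < m := by exact_mod_cast hm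
  have h1 := Stirling.le_factorial_stirling m
  have h2 : poissonTerm N m ≤ N ^ m * exp (-N) * √(2 * π * N) / (√(2 * π * m) * (m / exp 1) ^ m) := by
    unfold poissonTerm
    gcongr
  have h3 : N ^ m * exp (-N) * √(2 * π * N) / (√(2 * π * m) * (m / exp 1) ^ m)
      = √(N / m) * ((N / m) ^ m * exp (m - N)) := by
    rw [div_pow, div_pow, ← exp_nat_mul, mul_one, sub_eq_add_neg, exp_add,
      sqrt_mul (by positivity) N, sqrt_mul (by positivity) (m : ℝ), sqrt_div hN.le]
    field_simp
  -- The constant `√(2π)` is dictated by `m = 0`, where the claimed bound is an equality.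
  have h4 : √(N / m) ≤ √(2 * π) * √(N / (m + 1)) := by
    rw [← sqrt_mul (by positivity)]
    apply sqrt_le_sqrt
    rw [← mul_div_assoc, div_le_div_iff₀ hm' (by positivity)]
    have hm1 : (1 : ℝ) ≤ m := by exact_mod_cast hm
    have : N * (m + 1) ≤ N * (2 * m) := by gcongr; linarith
    nlinarith [pi_gt_three, mul_pos hN hm']
  rw [h3] at h2
  exact h2.trans (mul_le_mul h4 (pow_mul_exp_le hN hm) (by positivity) (by positivity))

/-- Second-order expansion of `(1 + t) log (1 + t) - t` at `0`. -/
lemma abs_mul_log_sub_le {t : ℝ} (ht : |t| ≤ 1 / 2) :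
    |(1 + t) * log (1 + t) - t - t ^ 2 / 2| ≤ 4 * |t| ^ 3 := by
  have h := abs_log_sub_add_sum_range_le (x := -t) (by rw [abs_neg]; linarith) 2
  simp only [Finset.sum_range_succ, Finset.sum_range_zero, abs_neg, sub_neg_eq_add] at h
  norm_num at h
  have h1 : |t| ^ 3 / (1 - |t|) ≤ 2 * |t| ^ 3 := by
    rw [div_le_iff₀ (by linarith)]
    nlinarith [pow_nonneg (abs_nonneg t) 3]
  -- The logarithm's remainder contributes at most `3/2 * 2` and the cross term `t³/2` another
  -- `1/2`, which the constant 4 covers.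
  have h2 : (1 + t) * log (1 + t) - t - t ^ 2 / 2
      = (1 + t) * (-t + t ^ 2 / 2 + log (1 + t)) - t ^ 3 / 2 := by ring
  have h3 : |1 + t| ≤ 3 / 2 := by
    rw [abs_le] at ht ⊢
    constructor <;> linarith
  rw [h2]
  refine (abs_sub _ _).trans ?_
  rw [abs_mul, abs_div, abs_pow, abs_two]
  have := mul_le_mul h3 (h.trans h1) (abs_nonneg _) (by norm_num)
  nlinarith [pow_nonneg (abs_nonneg t) 3]

/-- With `m = N (1 + t)`, the term equals `√π / stirlingSeq m` times `(1 + t) ^ (-1/2)` times `exp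
(-N ((1 + t) log (1 + t) - t))`, where `t → 0` and `N t² → z²`. The first two conclusions serve to
pass from `m!` to `Γ(m + a)`. -/
lemma tendsto_poissonTerm {N : ℕ → ℝ} {m : ℕ → ℕ} {z : ℝ} (hN : Tendsto N atTop atTop)
    (hm : Tendsto (fun n => ((m n : ℝ) - N n) / √(N n)) atTop (𝓝 z)) :
    Tendsto (fun n => ((m n : ℝ) + 1) / N n) atTop (𝓝 1) ∧ Tendsto m atTop atTop ∧
    Tendsto (fun n => poissonTerm (N n) (m n)) atTop (𝓝 (exp (-(z ^ 2 / 2)))) := by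
  have hsq : Tendsto (fun n => √(N n)) atTop atTop := tendsto_sqrt_atTop.comp hN
  have hNpos : ∀ᶠ n in atTop, 0 < N n := hN.eventually_gt_atTop 0
  set t : ℕ → ℝ := fun n => ((m n : ℝ) - N n) / N n with ht
  have ht0 : Tendsto t atTop (𝓝 0) := by
    have := hm.div_atTop hsq
    refine this.congr' ?_
    filter_upwards [hNpos] with n hn
    rw [ht, div_div, mul_self_sqrt hn.le]
  have hmN : ∀ᶠ n in atTop, (m n : ℝ) = N n * (1 + t n) := by
    filter_upwards [hNpos] with n hn
    simp only [ht]
    field_simp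
    ring
  have h1t : Tendsto (fun n => 1 + t n) atTop (𝓝 1) := by simpa using ht0.const_add 1
  have hmtop : Tendsto m atTop atTop := by
    rw [← tendsto_natCast_atTop_iff (R := ℝ)]
    refine (hN.atTop_mul_pos one_pos h1t).congr' ?_
    filter_upwards [hmN] with n hn using hn.symm
  refine ⟨?_, hmtop, ?_⟩
  · have := h1t.add (tendsto_inv_atTop_zero.comp hN)
    rw [add_zero] at this
    refine this.congr' ?_
    filter_upwards [hNpos, hmN] with n hn hmn
    simp only [Function.comp]
    rw [hmn]
    field_simp
  have hNt2 : Tendsto (fun n => N n * t n ^ 2) atTop (𝓝 (z ^ 2)) := by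
    refine (hm.pow 2).congr' ?_
    filter_upwards [hNpos] with n hn
    simp only [ht, div_pow, sq_sqrt hn.le]
    field_simp
  have hexp : Tendsto (fun n => N n * ((1 + t n) * log (1 + t n) - t n)) atTop (𝓝 (z ^ 2 / 2)) := by
    have hdiff : Tendsto (fun n => N n * ((1 + t n) * log (1 + t n) - t n) - N n * t n ^ 2 / 2)
        atTop (𝓝 0) := by
      have hb : Tendsto (fun n => 4 * (N n * t n ^ 2) * |t n|) atTop (𝓝 0) := by
        simpa using (hNt2.const_mul 4).mul ht0.abs
      refine squeeze_zero_norm' ?_ hb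
      have hsmall : ∀ᶠ n in atTop, |t n| ≤ 1 / 2 := by
        have := ht0.abs
        rw [abs_zero] at this
        exact this.eventually_le_const (by norm_num)
      filter_upwards [hNpos, hsmall] with n hn hs
      have := abs_mul_log_sub_le hs
      rw [norm_eq_abs, show N n * ((1 + t n) * log (1 + t n) - t n) - N n * t n ^ 2 / 2
        = N n * ((1 + t n) * log (1 + t n) - t n - t n ^ 2 / 2) by ring, abs_mul, abs_of_pos hn]
      calc _ ≤ N n * (4 * |t n| ^ 3) := by gcongr
        _ = _ := by rw [pow_succ, sq_abs]; ring
    simpa using hdiff.add (hNt2.div_const 2)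
  have hst : Tendsto (fun n => √π / Stirling.stirlingSeq (m n)) atTop (𝓝 1) := by
    have hpi : √π ≠ 0 := by positivity
    have h := (tendsto_const_nhds (x := √π)).div (Stirling.tendsto_stirlingSeq_sqrt_pi.comp hmtop) hpi
    rwa [div_self hpi] at h
  have hsqrt : Tendsto (fun n => (√(1 + t n))⁻¹) atTop (𝓝 1) := by
    simpa using (h1t.sqrt).inv₀ (by simp)
  have h := (hst.mul hsqrt).mul (hexp.neg.rexp)
  simp only [mul_one, one_mul] at h
  refine h.congr' ?_
  filter_upwards [hNpos, hmN, h1t.eventually_const_lt (show (0 : ℝ) < 1 by norm_num)]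
    with n hn hmn h1
  have hmpos : (0 : ℝ) < m n := by rw [hmn]; positivity
  have e1 : exp (-(N n * ((1 + t n) * log (1 + t n) - t n)))
      = N n ^ m n * exp (-N n) / ((m n : ℝ) / exp 1) ^ m n := by
    have : log (1 + t n) = log (m n) - log (N n) := by
      rw [hmn, log_mul hn.ne' h1.ne']
      ring
    have e2 : -(N n * ((1 + t n) * log (1 + t n) - t n))
        = m n * log (N n) + (-N n) - m n * (log (m n) - 1) := by
      rw [this]
      have : N n * t n = m n - N n := by rw [hmn]; ring
      linear_combination this - (log (m n) - log (N n)) * hmn.symm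
    rw [e2, exp_sub, exp_add, exp_nat_mul, exp_nat_mul, exp_sub, exp_log hn, exp_log hmpos]
  have e3 : √(m n : ℝ) = √(N n) * √(1 + t n) := by rw [hmn, sqrt_mul hn.le]
  rw [e1, poissonTerm, Stirling.stirlingSeq]
  have : √(1 + t n) ≠ 0 := by positivity
  rw [sqrt_mul (by positivity) (m n : ℝ), sqrt_mul (by positivity) (N n),
    sqrt_mul (by positivity) π, e3]
  field_simp

/-! ### Gamma-shifted Poisson weights: limit and uniform decay -/

/-- The variant of `poissonTerm` with `m!` replaced by `Γ (m + a)`. -/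
def gammaTerm (a N : ℝ) (m : ℕ) : ℝ :=
  N ^ m * exp (-N) * √(2 * π * N) * N ^ (a - 1) / Gamma (m + a)

lemma gammaTerm_eq {a N : ℝ} (hN : 0 < N) (m : ℕ) :
    gammaTerm a N m = poissonTerm N m * (N / (m + 1)) ^ (a - 1) * (gammaRatio a m)⁻¹ := by
  have : ((m : ℝ) + 1) ^ (a - 1) ≠ 0 := by positivity
  rw [gammaTerm, Gamma_eq_gammaRatio, poissonTerm, div_rpow hN.le (by positivity)]
  field_simp

lemma gammaTerm_pos {a N : ℝ} (ha : 0 < a) (hN : 0 < N) (m : ℕ) : 0 < gammaTerm a N m := by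
  have := Gamma_pos_of_pos (show (0 : ℝ) < m + a by positivity)
  unfold gammaTerm
  positivity

lemma tendsto_gammaTerm {a : ℝ} (ha : 0 < a) {N : ℕ → ℝ} {m : ℕ → ℕ} {z : ℝ}
    (hN : Tendsto N atTop atTop)
    (hm : Tendsto (fun n => ((m n : ℝ) - N n) / √(N n)) atTop (𝓝 z)) :
    Tendsto (fun n => gammaTerm a (N n) (m n)) atTop (𝓝 (exp (-(z ^ 2 / 2)))) := by
  obtain ⟨h1, h2, h3⟩ := tendsto_poissonTerm hN hm
  have h4 : Tendsto (fun n => (N n / (m n + 1)) ^ (a - 1)) atTop (𝓝 1) := by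
    have h := (h1.inv₀ one_ne_zero).rpow_const (p := a - 1) (by simp)
    simpa using h
  have h5 := ((tendsto_gammaRatio ha).comp h2).inv₀ one_ne_zero
  have h := (h3.mul h4).mul h5
  simp only [inv_one, mul_one] at h
  refine h.congr' ?_
  filter_upwards [hN.eventually_gt_atTop 0] with n hn
  exact (gammaTerm_eq hn _).symm

lemma exists_rpow_mul_exp_le {q c : ℝ} (hq : 0 ≤ q) (hc : 0 < c) (M : ℝ) :
    ∃ K : ℝ, 0 < K ∧ ∀ z : ℝ, (2 + 4 * z ^ 2) ^ q * exp (-(c * z ^ 2)) ≤ K * exp (-(M * |z|)) := by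
  -- The polynomial factor may cost at most half of the Gaussian, `q ε ≤ c / 2`; the other half
  -- absorbs `M |z|` by completing the square. Using `q + 1` allows `q = 0`.
  set ε := min 2 (c / (2 * (q + 1))) with hε
  have hε0 : 0 < ε := by positivity
  have hqε : q * ε ≤ c / 2 := by
    calc q * ε ≤ (q + 1) * (c / (2 * (q + 1))) := by
          gcongr
          · linarith
          · exact min_le_right _ _
      _ = c / 2 := by field_simp
  refine ⟨(4 / ε) ^ q * exp (M ^ 2 / (2 * c)), by positivity, fun z => ?_⟩
  have h1 : 2 + 4 * z ^ 2 ≤ 4 / ε * exp (ε * z ^ 2) := by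
    have h2 : ε / 2 + ε * z ^ 2 ≤ exp (ε * z ^ 2) := by
      have := add_one_le_exp (ε * z ^ 2)
      have : ε ≤ 2 := min_le_left _ _
      linarith
    calc 2 + 4 * z ^ 2 = 4 / ε * (ε / 2 + ε * z ^ 2) := by field_simp; ring
      _ ≤ _ := by gcongr
  have h3 : (2 + 4 * z ^ 2) ^ q ≤ (4 / ε) ^ q * exp (q * ε * z ^ 2) := by
    calc _ ≤ (4 / ε * exp (ε * z ^ 2)) ^ q := by gcongr
      _ = _ := by
        rw [mul_rpow (by positivity) (by positivity), ← exp_mul]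
        ring_nf
  calc _ ≤ (4 / ε) ^ q * exp (q * ε * z ^ 2) * exp (-(c * z ^ 2)) := by gcongr
    _ = (4 / ε) ^ q * exp (q * ε * z ^ 2 - c * z ^ 2) := by
      rw [mul_assoc, ← exp_add, sub_eq_add_neg]
    _ ≤ (4 / ε) ^ q * exp (M ^ 2 / (2 * c) - M * |z|) := by
      refine mul_le_mul_of_nonneg_left (exp_le_exp.2 ?_) (by positivity)
      have h4 : q * ε * z ^ 2 ≤ c / 2 * z ^ 2 := by gcongr
      have h5 : 0 ≤ (M - c * |z|) ^ 2 / (2 * c) := by positivity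
      have h6 : (M - c * |z|) ^ 2 / (2 * c) = M ^ 2 / (2 * c) - M * |z| + c / 2 * z ^ 2 := by
        rw [← sq_abs z]
        field_simp
        ring
      linarith
    _ = _ := by rw [sub_eq_add_neg, exp_add, mul_assoc]

/-- For `m ≤ D N`, `|√m - √N|` is at least `|z| / (√D + 1)`, so `poissonTerm_le` gives Gaussian
decay in `z`, which beats any exponential. What remains is a power of `N / (m + 1)`. The rate `M` is
left free so that it can later outweigh the pair factors. -/
lemma exists_gammaTerm_le {a D : ℝ} (ha : 0 < a) (hD : 1 ≤ D) (M : ℝ) :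
    ∃ C : ℝ, 0 < C ∧ ∀ (N : ℝ) (m : ℕ), 1 ≤ D * N → (m : ℝ) ≤ D * N →
      gammaTerm a N m ≤ C * exp (-(M * |((m : ℝ) - N) / √N|)) := by
  have hD0 : 0 < D := by linarith
  obtain ⟨C₁, hC₁, hr⟩ := exists_gammaRatio_bounds ha
  set p := a - 1 / 2 with hp
  set c := 1 / (√D + 1) ^ 2 with hc
  have hc0 : 0 < c := by positivity
  obtain ⟨K, hK, hKz⟩ := exists_rpow_mul_exp_le (abs_nonneg p) hc0 M
  refine ⟨√(2 * π) * ((2 * D) ^ |p| * K) * C₁, by positivity, fun N m h1 h2 => ?_⟩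
  have hN : 0 < N := by
    by_contra! h
    nlinarith
  set z := ((m : ℝ) - N) / √N with hz
  have hzN : z ^ 2 * N = (m - N) ^ 2 := by
    rw [hz, div_pow, sq_sqrt hN.le]
    field_simp
  have e1 : exp (-(√m - √N) ^ 2) ≤ exp (-(c * z ^ 2)) := by
    rw [exp_le_exp, neg_le_neg_iff]
    have hs : √(m : ℝ) ≤ √D * √N := by
      rw [← sqrt_mul hD0.le]
      exact sqrt_le_sqrt h2
    have hz' : z = (√m - √N) * ((√m + √N) / √N) := by
      rw [hz, ← mul_div_assoc]
      congr 1
      nlinarith [sq_sqrt hN.le, sq_sqrt (Nat.cast_nonneg (α := ℝ) m)]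
    have h3 : (√m + √N) / √N ≤ √D + 1 := by
      rw [div_le_iff₀ (by positivity)]
      linarith
    rw [hc, hz', mul_pow, one_div, inv_mul_le_iff₀ (by positivity), mul_comm]
    gcongr
  have e2 : (N / (m + 1)) ^ p ≤ (2 * D) ^ |p| * (2 + 4 * z ^ 2) ^ |p| := by
    have g1 : (1 : ℝ) ≤ (2 * D) ^ |p| := one_le_rpow (by linarith) (abs_nonneg _)
    have g2 : (1 : ℝ) ≤ (2 + 4 * z ^ 2) ^ |p| :=
      one_le_rpow (by nlinarith [sq_nonneg z]) (abs_nonneg _)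
    -- For a positive exponent, `N / (m + 1)` is large only when `m ≤ N / 2`, and then `z² ≥ N / 4`.
    -- For a negative one, `(m + 1) / N ≤ 2 D` suffices.
    rcases le_total 0 p with hp0 | hp0
    · have : N / (m + 1) ≤ 2 + 4 * z ^ 2 := by
        rw [div_le_iff₀ (by positivity)]
        rcases le_total N (2 * m) with h | h
        · nlinarith [mul_nonneg (sq_nonneg z) (by positivity : (0 : ℝ) ≤ (m : ℝ) + 1)]
        · have : N * N ≤ 4 * z ^ 2 * N := by nlinarith
          have : N ≤ 4 * z ^ 2 := le_of_mul_le_mul_right this hN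
          nlinarith [mul_nonneg (sq_nonneg z) (Nat.cast_nonneg (α := ℝ) m),
            Nat.cast_nonneg (α := ℝ) m]
      rw [abs_of_nonneg hp0] at g1 g2 ⊢
      calc (N / (m + 1)) ^ p ≤ (2 + 4 * z ^ 2) ^ p := by gcongr
        _ ≤ _ := le_mul_of_one_le_left (by positivity) g1
    · have : ((m : ℝ) + 1) / N ≤ 2 * D := by
        rw [div_le_iff₀ hN]
        linarith
      have h3 : (N / (m + 1)) ^ p = (((m : ℝ) + 1) / N) ^ |p| := by
        rw [abs_of_nonpos hp0, rpow_neg (by positivity), ← inv_rpow (by positivity), inv_div]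
      rw [h3]
      calc (((m : ℝ) + 1) / N) ^ |p| ≤ (2 * D) ^ |p| := by gcongr
        _ ≤ _ := le_mul_of_one_le_right (by positivity) g2
  have e3 : √(N / (m + 1)) * (N / (m + 1)) ^ (a - 1) = (N / (m + 1)) ^ p := by
    rw [sqrt_eq_rpow, ← rpow_add (by positivity), hp]
    ring_nf
  rw [gammaTerm_eq hN]
  have hri := (inv_pos.2 (gammaRatio_pos ha m)).le
  calc poissonTerm N m * (N / (m + 1)) ^ (a - 1) * (gammaRatio a m)⁻¹
      ≤ (√(2 * π) * √(N / (m + 1)) * exp (-(c * z ^ 2))) * (N / (m + 1)) ^ (a - 1) * C₁ := by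
        gcongr
        · exact (poissonTerm_le hN m).trans (by gcongr)
        · exact (hr m).2
    _ = √(2 * π) * ((N / (m + 1)) ^ p * exp (-(c * z ^ 2))) * C₁ := by rw [← e3]; ring
    _ ≤ √(2 * π) * ((2 * D) ^ |p| * (2 + 4 * z ^ 2) ^ |p| * exp (-(c * z ^ 2))) * C₁ := by gcongr
    _ ≤ √(2 * π) * ((2 * D) ^ |p| * (K * exp (-(M * |z|)))) * C₁ := by
        rw [mul_assoc ((2 * D) ^ |p|)]
        have := hKz z
        gcongr
    _ = _ := by ring

/-! ### Pair factors: limit and exponential growth bound -/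

/-- The contribution to the Jack weight of two rows at distance `t` whose lengths differ by `m`. -/
def pairTerm (α t : ℝ) (m : ℕ) : ℝ :=
  (Gamma (m + (t + 1) / α) * Gamma (m + (t / α + 1))) /
    (Gamma (m + t / α) * Gamma (m + ((t - 1) / α + 1)))

lemma pairTerm_pos {α t : ℝ} (hα : 0 < α) (ht : 1 ≤ t) (m : ℕ) : 0 < pairTerm α t m := by
  have : 0 ≤ t - 1 := by linarith
  have ht0 : 0 < t := by linarith
  have := Gamma_pos_of_pos (show (0 : ℝ) < m + (t + 1) / α by positivity)
  have := Gamma_pos_of_pos (show (0 : ℝ) < m + (t / α + 1) by positivity)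
  have := Gamma_pos_of_pos (show (0 : ℝ) < m + t / α by positivity)
  have := Gamma_pos_of_pos (show (0 : ℝ) < m + ((t - 1) / α + 1) by positivity)
  unfold pairTerm
  positivity

/-- The factorials cancel and the four exponents combine to `2 / α` independently of `t`. This is
the origin of `β`. -/
lemma pairTerm_eq {α t : ℝ} (m : ℕ) :
    pairTerm α t m = ((m : ℝ) + 1) ^ (2 / α) *
      (gammaRatio ((t + 1) / α) m * gammaRatio (t / α + 1) m *
        (gammaRatio (t / α) m)⁻¹ * (gammaRatio ((t - 1) / α + 1) m)⁻¹) := by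
  have hm : (0 : ℝ) < m + 1 := by positivity
  have h : ((m : ℝ) + 1) ^ (2 / α) = ((m : ℝ) + 1) ^ ((t + 1) / α - 1) *
      ((m : ℝ) + 1) ^ (t / α + 1 - 1) / (((m : ℝ) + 1) ^ (t / α - 1) *
      ((m : ℝ) + 1) ^ ((t - 1) / α + 1 - 1)) := by
    rw [← rpow_add hm, ← rpow_add hm, ← rpow_sub hm]
    ring_nf
  rw [pairTerm, h]
  simp only [Gamma_eq_gammaRatio]
  have : ∀ x : ℝ, ((m : ℝ) + 1) ^ x ≠ 0 := fun x => by positivity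
  have h1 := this (t / α - 1)
  have h2 := this ((t - 1) / α + 1 - 1)
  have hf : (m.factorial : ℝ) ≠ 0 := by positivity
  rw [mul_mul_mul_comm, mul_mul_mul_comm (gammaRatio (t / α) m), mul_div_mul_comm,
    mul_mul_mul_comm (m.factorial : ℝ) (_ ^ ((t + 1) / α - 1)),
    mul_mul_mul_comm (m.factorial : ℝ) (_ ^ (t / α - 1)),
    mul_div_mul_left _ _ (by positivity)]
  rw [div_eq_mul_inv (_ * gammaRatio _ _), mul_inv]
  ring

lemma tendsto_pairTerm {α t : ℝ} (hα : 0 < α) (ht : 1 ≤ t) {s : ℕ → ℝ} {m : ℕ → ℕ} {z : ℝ}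
    (hs0 : ∀ n, 0 ≤ s n) (hs : Tendsto s atTop (𝓝 0)) (hz : 0 < z)
    (hm : Tendsto (fun n => s n * m n) atTop (𝓝 z)) :
    Tendsto (fun n => s n ^ (2 / α) * pairTerm α t (m n)) atTop (𝓝 (z ^ (2 / α))) := by
  have ht0 : 0 < t := by linarith
  have ht1 : 0 ≤ t - 1 := by linarith
  have hspos : ∀ᶠ n in atTop, 0 < s n := by
    filter_upwards [hm.eventually_const_lt hz] with n hn
    exact (hs0 n).lt_of_ne fun h => by simp [← h] at hn
  have hmtop : Tendsto m atTop atTop := by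
    rw [← tendsto_natCast_atTop_iff (R := ℝ)]
    have hsi : Tendsto (fun n => (s n)⁻¹) atTop atTop :=
      tendsto_inv_nhdsGT_zero.comp (tendsto_nhdsWithin_iff.2 ⟨hs, hspos⟩)
    refine (hm.pos_mul_atTop hz hsi).congr' ?_
    filter_upwards [hspos] with n hn
    field_simp
  have key : ∀ b : ℝ, 0 < b → Tendsto (fun n => gammaRatio b (m n)) atTop (𝓝 1) :=
    fun b hb => (tendsto_gammaRatio hb).comp hmtop
  have h1 := key ((t + 1) / α) (by positivity)
  have h2 := key (t / α + 1) (by positivity)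
  have h3 := (key (t / α) (by positivity)).inv₀ one_ne_zero
  have h4 := (key ((t - 1) / α + 1) (by positivity)).inv₀ one_ne_zero
  have h5 : Tendsto (fun n => (s n * m n + s n) ^ (2 / α)) atTop (𝓝 (z ^ (2 / α))) := by
    have := hm.add hs
    rw [add_zero] at this
    exact this.rpow_const (Or.inl hz.ne')
  have h := h5.mul (((h1.mul h2).mul h3).mul h4)
  simp only [inv_one, mul_one] at h
  refine h.congr fun n => ?_
  rw [pairTerm_eq, show s n * m n + s n = s n * (m n + 1) by ring,
    mul_rpow (hs0 n) (by positivity)]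
  ring

/-- The ratios are bounded, and `s (m + 1) ≤ (|S| + 1)(s m + 1) ≤ (|S| + 1) exp (s m)`. -/
lemma exists_pairTerm_le {α t : ℝ} (hα : 0 < α) (ht : 1 ≤ t) (S : ℝ) :
    ∃ C : ℝ, 0 < C ∧ ∀ (s : ℝ) (m : ℕ), 0 ≤ s → s ≤ S →
      s ^ (2 / α) * pairTerm α t m ≤ C * exp (2 / α * (s * m)) := by
  have ht0 : 0 < t := by linarith
  have ht1 : 0 ≤ t - 1 := by linarith
  have p1 : 0 < (t + 1) / α := by positivity
  have p2 : 0 < t / α + 1 := by positivity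
  have p3 : 0 < t / α := by positivity
  have p4 : 0 < (t - 1) / α + 1 := by positivity
  obtain ⟨C₁, hC₁, h1⟩ := exists_gammaRatio_bounds p1
  obtain ⟨C₂, hC₂, h2⟩ := exists_gammaRatio_bounds p2
  obtain ⟨C₃, hC₃, h3⟩ := exists_gammaRatio_bounds p3
  obtain ⟨C₄, hC₄, h4⟩ := exists_gammaRatio_bounds p4
  refine ⟨(|S| + 1) ^ (2 / α) * (C₁ * C₂ * C₃ * C₄), by positivity, fun s m hs hS => ?_⟩
  have g1 := gammaRatio_pos p1 m
  have g2 := gammaRatio_pos p2 m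
  have g3 := gammaRatio_pos p3 m
  have g4 := gammaRatio_pos p4 m
  have e : s ^ (2 / α) * ((m : ℝ) + 1) ^ (2 / α) ≤ (|S| + 1) ^ (2 / α) * exp (2 / α * (s * m)) := by
    rw [← mul_rpow hs (by positivity), mul_comm (2 / α) (s * m), exp_mul,
      ← mul_rpow (by positivity) (by positivity)]
    refine rpow_le_rpow (by positivity) ?_ (by positivity)
    have hsm : 0 ≤ s * m := by positivity
    have h5 := add_one_le_exp (s * m)
    calc s * (m + 1) ≤ (|S| + 1) * (s * m + 1) := by
          nlinarith [le_abs_self S, mul_nonneg (abs_nonneg S) hsm]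
      _ ≤ _ := by gcongr
  rw [pairTerm_eq, ← mul_assoc]
  calc _ ≤ ((|S| + 1) ^ (2 / α) * exp (2 / α * (s * m))) * (C₁ * C₂ * C₃ * C₄) := by
        gcongr
        exacts [(h1 m).1, (h2 m).1, (h3 m).2, (h4 m).2]
    _ = _ := by ring

/-! ### Hook products as products of Gamma functions -/

lemma mem_partitions {d n : ℕ} {l : Fin d → ℕ} :
    l ∈ partitions d n ↔ ∑ i, l i = n ∧ Antitone l := by
  simp [partitions, Antitone]

lemma prod_Ico_eq_Gamma_div {α s : ℝ} (hα : 0 < α) (hs : 0 < s) {A B L : ℕ} (hBA : B ≤ A)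
    (hAL : A ≤ L) :
    ∏ j ∈ Finset.Ico B A, (α * ((L : ℝ) - ((j : ℝ) + 1)) + s) =
      α ^ (A - B) * (Gamma ((L : ℝ) - B + s / α) / Gamma ((L : ℝ) - A + s / α)) := by
  induction A, hBA using Nat.le_induction with
  | base =>
    have hB : (B : ℝ) ≤ L := by exact_mod_cast hAL
    have : 0 < Gamma ((L : ℝ) - B + s / α) :=
      Gamma_pos_of_pos (add_pos_of_nonneg_of_pos (by linarith) (by positivity))
    simp [div_self this.ne']
  | succ A hBA ih =>
    have hA : (A : ℝ) + 1 ≤ L := by exact_mod_cast hAL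
    have hx : 0 < (L : ℝ) - (A + 1) + s / α :=
      add_pos_of_nonneg_of_pos (by linarith) (by positivity)
    have hG := Gamma_pos_of_pos hx
    have hrec : Gamma ((L : ℝ) - A + s / α)
        = ((L : ℝ) - (A + 1) + s / α) * Gamma ((L : ℝ) - (A + 1) + s / α) := by
      rw [← Gamma_add_one hx.ne']
      ring_nf
    rw [Finset.prod_Ico_succ_top hBA, ih (by omega), Nat.sub_add_comm hBA, pow_succ, hrec]
    push_cast
    rw [show α * ((L : ℝ) - ((A : ℝ) + 1)) + s = α * ((L : ℝ) - (A + 1) + s / α) by field_simp]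
    generalize Gamma ((L : ℝ) - B + s / α) = G
    generalize Gamma ((L : ℝ) - (A + 1) + s / α) = G' at hG
    generalize (L : ℝ) - (A + 1) + s / α = y at hx
    field_simp

/-- Induction on the number of pieces into which the lower rows cut row `i`. Each piece has constant
leg and contributes a Gamma ratio; at a common endpoint two Gamma values meet with arguments
differing by `1 / α`. -/
lemma prod_row_eq_Gamma {α e : ℝ} (hα : 0 < α) (he : 0 < e) {lam c : ℕ → ℕ} (hlam : Antitone lam)
    {i : ℕ} (t : ℕ) (hc : ∀ k ≤ i + t, ∀ j ∈ Finset.Ico (lam (k + 1)) (lam k), c j = k + 1) :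
    ∏ j ∈ Finset.Ico (lam (i + 1 + t)) (lam i),
        (α * ((lam i : ℝ) - ((j : ℝ) + 1)) + ((c j : ℝ) - ((i : ℝ) + 1)) + e) =
      α ^ (lam i - lam (i + 1 + t)) *
        (Gamma ((lam i : ℝ) - lam (i + 1 + t) + (t + e) / α) / Gamma (e / α)) *
        ∏ k ∈ Finset.range t, Gamma ((lam i : ℝ) - lam (i + 1 + k) + (k + e) / α) /
          Gamma ((lam i : ℝ) - lam (i + 1 + k) + (k + 1 + e) / α) := by
  induction t with
  | zero =>
    have h := prod_Ico_eq_Gamma_div hα he (hlam (Nat.le_succ i)) le_rfl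
    simp only [sub_self, zero_add] at h
    simp only [Finset.range_zero, Finset.prod_empty, mul_one, add_zero, Nat.cast_zero, zero_add]
    rw [← h]
    refine Finset.prod_congr rfl fun j hj => ?_
    rw [hc i (by omega) j hj]
    push_cast
    ring
  | succ t ih =>
    have h1 : lam (i + 1 + t) ≤ lam i := hlam (by omega)
    have h2 : lam (i + 1 + (t + 1)) ≤ lam (i + 1 + t) := hlam (by omega)
    have h := prod_Ico_eq_Gamma_div hα (show (0 : ℝ) < t + 1 + e by positivity) h2 h1
    rw [← Finset.prod_Ico_consecutive _ h2 h1, ih fun k hk => hc k (by omega),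
      Finset.prod_range_succ]
    have h3 : ∏ j ∈ Finset.Ico (lam (i + 1 + (t + 1))) (lam (i + 1 + t)),
        (α * ((lam i : ℝ) - ((j : ℝ) + 1)) + ((c j : ℝ) - ((i : ℝ) + 1)) + e) =
        ∏ j ∈ Finset.Ico (lam (i + 1 + (t + 1))) (lam (i + 1 + t)),
        (α * ((lam i : ℝ) - ((j : ℝ) + 1)) + (t + 1 + e)) := by
      refine Finset.prod_congr rfl fun j hj => ?_
      rw [hc (i + 1 + t) (by omega) j (by rwa [add_assoc (i + 1)])]
      push_cast
      ring
    rw [h3, h, show lam i - lam (i + 1 + (t + 1))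
      = (lam (i + 1 + t) - lam (i + 1 + (t + 1))) + (lam i - lam (i + 1 + t)) by omega, pow_add]
    push_cast
    ring

/-- The rows of `l`, continued by zero. -/
def extend {d : ℕ} (l : Fin d → ℕ) (k : ℕ) : ℕ := if h : k < d then l ⟨k, h⟩ else 0

lemma extend_coe {d : ℕ} (l : Fin d → ℕ) (k : Fin d) : extend l k = l k := by
  simp [extend]

lemma extend_self {d : ℕ} (l : Fin d → ℕ) : extend l d = 0 := by
  simp [extend]

lemma antitone_extend {d : ℕ} {l : Fin d → ℕ} (hl : Antitone l) : Antitone (extend l) := by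
  intro j k hjk
  unfold extend
  split_ifs with h1 h2
  · exact hl (by simpa using hjk)
  · omega
  · exact Nat.zero_le _
  · exact le_rfl

lemma conjPart_eq {d : ℕ} {l : Fin d → ℕ} (hl : Antitone l) {k j : ℕ} (hk : k < d)
    (hj : j ∈ Finset.Ico (extend l (k + 1)) (extend l k)) : conjPart l j = k + 1 := by
  rw [Finset.mem_Ico] at hj
  have : (Finset.univ.filter fun x : Fin d => j < l x) = Finset.Iic ⟨k, hk⟩ := by
    ext x
    simp only [Finset.mem_filter, Finset.mem_univ, true_and, Finset.mem_Iic, Fin.le_def]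
    rw [← extend_coe l x]
    constructor
    · intro h
      by_contra! hx
      have := antitone_extend hl (show k + 1 ≤ x from hx)
      omega
    · intro h
      have := antitone_extend hl h
      omega
  rw [conjPart, this, Fin.card_Iic]

/-- The common generalization of `hookLower` and `hookUpper`. -/
def hookProd {d : ℕ} (α e : ℝ) (l : Fin d → ℕ) : ℝ :=
  ∏ i : Fin d, ∏ j ∈ Finset.range (l i), (α * arm l i j + leg l i j + e)

lemma hookProd_eq_Gamma {d : ℕ} {α e : ℝ} (hα : 0 < α) (he : 0 < e) {l : Fin d → ℕ}
    (hl : Antitone l) :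
    hookProd α e l = ∏ i : Fin d, (α ^ l i *
      (Gamma ((l i : ℝ) + ((d : ℝ) - 1 - i + e) / α) / Gamma (e / α)) *
        ∏ k ∈ Finset.univ.filter (fun k : Fin d => i < k),
          Gamma (((l i - l k : ℕ) : ℝ) + ((k : ℝ) - i - 1 + e) / α) /
          Gamma (((l i - l k : ℕ) : ℝ) + ((k : ℝ) - i + e) / α)) := by
  refine Finset.prod_congr rfl fun i _ => ?_
  have hi := i.isLt
  -- `t` counts the rows below row `i`; the added zero row of index `d` closes the last piece at
  -- column 0.
  obtain ⟨t, ht⟩ : ∃ t, d = i + 1 + t := ⟨d - (i + 1), by omega⟩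
  have htr : (d : ℝ) = i + 1 + t := by exact_mod_cast ht
  have h := prod_row_eq_Gamma hα he (antitone_extend hl) (c := conjPart l) (i := i) t
    fun k hk j hj => conjPart_eq hl (by omega) hj
  rw [← ht, extend_self, extend_coe] at h
  have hlhs : ∏ j ∈ Finset.range (l i), (α * arm l i j + leg l i j + e)
      = ∏ j ∈ Finset.Ico 0 (l i),
        (α * ((l i : ℝ) - ((j : ℝ) + 1)) + ((conjPart l j : ℝ) - ((i : ℝ) + 1)) + e) := by
    rw [Finset.range_eq_Ico]
    rfl
  rw [hlhs, h, Nat.sub_zero, Nat.cast_zero, sub_zero,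
    show (d : ℝ) - 1 - i + e = t + e by rw [htr]; ring]
  congr 1
  have hI : ∏ k ∈ Finset.range t, Gamma ((l i : ℝ) - extend l (i + 1 + k) + (k + e) / α) /
          Gamma ((l i : ℝ) - extend l (i + 1 + k) + (k + 1 + e) / α)
      = ∏ k ∈ Finset.Ico (i + 1 : ℕ) d,
          Gamma ((l i : ℝ) - extend l k + ((k : ℝ) - i - 1 + e) / α) /
          Gamma ((l i : ℝ) - extend l k + ((k : ℝ) - i + e) / α) := by
    rw [Finset.prod_Ico_eq_prod_range, show d - (i + 1 : ℕ) = t by omega]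
    refine Finset.prod_congr rfl fun k _ => ?_
    push_cast
    congr 3 <;> ring
  have hmap : Finset.Ico (i + 1 : ℕ) d
      = (Finset.univ.filter (fun k : Fin d => i < k)).map Fin.valEmbedding := by
    ext k
    simp only [Finset.mem_Ico, Finset.mem_map, Finset.mem_filter, Finset.mem_univ, true_and,
      Fin.valEmbedding_apply, Fin.lt_def]
    constructor
    · rintro ⟨h1, h2⟩
      exact ⟨⟨k, h2⟩, h1, rfl⟩
    · rintro ⟨x, hx, rfl⟩
      exact ⟨hx, x.isLt⟩
  rw [hI, hmap, Finset.prod_map]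
  refine Finset.prod_congr rfl fun k hk => ?_
  simp only [Finset.mem_filter, Finset.mem_univ, true_and] at hk
  rw [Fin.valEmbedding_apply, extend_coe, Nat.cast_sub (hl hk.le)]

lemma one_le_sub_of_lt {d : ℕ} {i k : Fin d} (h : i < k) : (1 : ℝ) ≤ (k : ℝ) - i := by
  have : ((i : ℕ) : ℝ) + 1 ≤ (k : ℕ) := by exact_mod_cast h
  linarith

lemma sub_one_sub_nonneg {d : ℕ} (i : Fin d) : (0 : ℝ) ≤ (d : ℝ) - 1 - i := by
  have : ((i : ℕ) : ℝ) + 1 ≤ d := by exact_mod_cast i.isLt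
  linarith

lemma hookProd_pos {d : ℕ} {α e : ℝ} (hα : 0 < α) (he : 0 < e) {l : Fin d → ℕ}
    (hl : Antitone l) : 0 < hookProd α e l := by
  rw [hookProd_eq_Gamma hα he hl]
  refine Finset.prod_pos fun i _ => ?_
  have h0 : 0 < Gamma (e / α) := Gamma_pos_of_pos (by positivity)
  have h1 : 0 < Gamma ((l i : ℝ) + ((d : ℝ) - 1 - i + e) / α) :=
    Gamma_pos_of_pos (by have := sub_one_sub_nonneg i; positivity)
  have h2 : 0 < ∏ k ∈ Finset.univ.filter (fun k : Fin d => i < k),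
      Gamma (((l i - l k : ℕ) : ℝ) + ((k : ℝ) - i - 1 + e) / α) /
        Gamma (((l i - l k : ℕ) : ℝ) + ((k : ℝ) - i + e) / α) := by
    refine Finset.prod_pos fun k hk => ?_
    simp only [Finset.mem_filter, Finset.mem_univ, true_and] at hk
    have h3 := one_le_sub_of_lt hk
    have h4 : (0 : ℝ) ≤ (k : ℝ) - i - 1 := by linarith
    have h5 : (0 : ℝ) ≤ (k : ℝ) - i := by linarith
    exact div_pos (Gamma_pos_of_pos (by positivity)) (Gamma_pos_of_pos (by positivity))
  positivity

lemma hookLower_eq {d : ℕ} (α : ℝ) (l : Fin d → ℕ) : hookLower α l = hookProd α 1 l := rfl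

lemma hookUpper_eq {d : ℕ} (α : ℝ) (l : Fin d → ℕ) : hookUpper α l = hookProd α α l := rfl

/-- The Jack weight, normalized so that it has a limit under the rescaling of `rescale`. -/
def localWeight (d : ℕ) (α : ℝ) (n : ℕ) (l : Fin d → ℕ) : ℝ :=
  (∏ i : Fin d, gammaTerm (((d : ℝ) - 1 - i + 1) / α) (n / d) (l i) *
    gammaTerm (((d : ℝ) - 1 - i) / α + 1) (n / d) (l i)) *
  ∏ i : Fin d, ∏ k ∈ Finset.univ.filter (fun k : Fin d => i < k),
    (√(α * d / n) ^ (2 / α) * pairTerm α ((k : ℝ) - i) (l i - l k))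

/-- The cases `e = 1` and `e = α` of `hookProd_eq_Gamma` are multiplied and inverted. The second has
`Γ(e / α) = Γ(1) = 1`, so only `Γ(1 / α)` survives. -/
lemma inv_hooks_eq_Gamma {d n : ℕ} {α : ℝ} (hα : 0 < α) {l : Fin d → ℕ}
    (hl : l ∈ partitions d n) :
    1 / (hookLower α l * hookUpper α l) = (α ^ n * α ^ n)⁻¹ * Gamma (1 / α) ^ d *
      (∏ i : Fin d, (Gamma ((l i : ℝ) + ((d : ℝ) - 1 - i + 1) / α) *
        Gamma ((l i : ℝ) + (((d : ℝ) - 1 - i) / α + 1)))⁻¹) *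
      ∏ i : Fin d, ∏ k ∈ Finset.univ.filter (fun k : Fin d => i < k),
        pairTerm α ((k : ℝ) - i) (l i - l k) := by
  obtain ⟨hsum, hanti⟩ := mem_partitions.1 hl
  have hG : Gamma (1 / α) ≠ 0 := (Gamma_pos_of_pos (by positivity)).ne'
  have hconst : ∀ x : ℝ, x ^ n = ∏ i : Fin d, x ^ l i := fun x => by
    rw [Finset.prod_pow_eq_pow_sum, hsum]
  have hconst' : Gamma (1 / α) ^ d = ∏ _i : Fin d, Gamma (1 / α) := by simp
  rw [hookLower_eq, hookUpper_eq, hookProd_eq_Gamma hα one_pos hanti,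
    hookProd_eq_Gamma hα hα hanti, hconst, hconst', one_div, ← Finset.prod_mul_distrib,
    ← Finset.prod_mul_distrib, ← Finset.prod_inv_distrib, ← Finset.prod_inv_distrib,
    ← Finset.prod_mul_distrib, ← Finset.prod_mul_distrib, ← Finset.prod_mul_distrib]
  refine Finset.prod_congr rfl fun i _ => ?_
  have hp : ∏ k ∈ Finset.univ.filter (fun k : Fin d => i < k), pairTerm α ((k : ℝ) - i) (l i - l k)
      = ((∏ k ∈ Finset.univ.filter (fun k : Fin d => i < k),
          Gamma (((l i - l k : ℕ) : ℝ) + ((k : ℝ) - i - 1 + 1) / α) /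
          Gamma (((l i - l k : ℕ) : ℝ) + ((k : ℝ) - i + 1) / α)) *
        (∏ k ∈ Finset.univ.filter (fun k : Fin d => i < k),
          Gamma (((l i - l k : ℕ) : ℝ) + ((k : ℝ) - i - 1 + α) / α) /
          Gamma (((l i - l k : ℕ) : ℝ) + ((k : ℝ) - i + α) / α)))⁻¹ := by
    rw [← Finset.prod_mul_distrib, ← Finset.prod_inv_distrib]
    refine Finset.prod_congr rfl fun k _ => ?_
    rw [pairTerm, div_mul_div_comm, inv_div, add_div _ α α, add_div _ α α, div_self hα.ne',
      sub_add_cancel]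
  rw [hp, add_div _ α α, div_self hα.ne', Gamma_one]
  simp only [mul_inv, div_eq_mul_inv, inv_one, mul_one, inv_inv]
  ring

/-- The inserted factors depend on `l` only through `∏ N ^ l i = N ^ n`. Hence `localWeight` may
replace the Jack weight in every normalized sum. -/
lemma exists_localWeight_eq {d n : ℕ} {α : ℝ} (hα : 0 < α) (hd : 0 < d) (hn : 0 < n) :
    ∃ K : ℝ, 0 < K ∧ ∀ l ∈ partitions d n,
      localWeight d α n l = K * (1 / (hookLower α l * hookUpper α l)) := by
  have hd' : (0 : ℝ) < d := by exact_mod_cast hd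
  have hn' : (0 : ℝ) < n := by exact_mod_cast hn
  set N : ℝ := n / d with hN
  have hN0 : 0 < N := by positivity
  have hG : 0 < Gamma (1 / α) := Gamma_pos_of_pos (by positivity)
  set s : ℝ := √(α * d / n) ^ (2 / α) with hs
  have hs0 : 0 < s := by positivity
  set K₁ : ℝ := ∏ i : Fin d, (exp (-N) * √(2 * π * N) * N ^ (((d : ℝ) - 1 - i + 1) / α - 1)) *
    (exp (-N) * √(2 * π * N) * N ^ (((d : ℝ) - 1 - i) / α + 1 - 1)) with hK₁
  have hK₁0 : 0 < K₁ := Finset.prod_pos fun i _ => by positivity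
  set K₂ : ℝ := ∏ i : Fin d, ∏ k ∈ Finset.univ.filter (fun k : Fin d => i < k), s with hK₂
  have hK₂0 : 0 < K₂ := Finset.prod_pos fun i _ => Finset.prod_pos fun k _ => hs0
  refine ⟨(α ^ n * α ^ n) * (Gamma (1 / α) ^ d)⁻¹ * (N ^ n * N ^ n * K₁) * K₂, by positivity,
    fun l hl => ?_⟩
  obtain ⟨hsum, hanti⟩ := mem_partitions.1 hl
  have hconst : N ^ n = ∏ i : Fin d, N ^ l i := by rw [Finset.prod_pow_eq_pow_sum, hsum]
  have e1 : (∏ i : Fin d, gammaTerm (((d : ℝ) - 1 - i + 1) / α) N (l i) *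
      gammaTerm (((d : ℝ) - 1 - i) / α + 1) N (l i)) = N ^ n * N ^ n * K₁ *
      ∏ i : Fin d, (Gamma ((l i : ℝ) + ((d : ℝ) - 1 - i + 1) / α) *
        Gamma ((l i : ℝ) + (((d : ℝ) - 1 - i) / α + 1)))⁻¹ := by
    rw [hconst, hK₁, ← Finset.prod_mul_distrib, ← Finset.prod_mul_distrib,
      ← Finset.prod_mul_distrib]
    refine Finset.prod_congr rfl fun i _ => ?_
    simp only [gammaTerm, div_eq_mul_inv, mul_inv]
    ring
  have e2 : ∏ i : Fin d, ∏ k ∈ Finset.univ.filter (fun k : Fin d => i < k),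
      (s * pairTerm α ((k : ℝ) - i) (l i - l k)) = K₂ *
      ∏ i : Fin d, ∏ k ∈ Finset.univ.filter (fun k : Fin d => i < k),
        pairTerm α ((k : ℝ) - i) (l i - l k) := by
    simp only [Finset.prod_mul_distrib, hK₂]
  rw [inv_hooks_eq_Gamma hα hl, localWeight, ← hN, ← hs, e1, e2]
  generalize (∏ i : Fin d, (Gamma ((l i : ℝ) + ((d : ℝ) - 1 - i + 1) / α) *
        Gamma ((l i : ℝ) + (((d : ℝ) - 1 - i) / α + 1)))⁻¹) = A
  field_simp

/-! ### Local limit theorem for the Jack weights -/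

lemma sqrt_scale_eq {d n : ℕ} {α : ℝ} (hα : 0 < α) :
    √(α * d / n) = √α / √((n : ℝ) / d) := by
  rw [← sqrt_div hα.le, div_div_eq_mul_div]

lemma sub_div_sqrt_eq {d n : ℕ} {α : ℝ} (hα : 0 < α) (l : Fin d → ℕ) (i : Fin d) :
    ((l i : ℝ) - (n : ℝ) / d) / √((n : ℝ) / d) = rescale d α n l i / √α := by
  have : √α ≠ 0 := by positivity
  rw [rescale, sqrt_scale_eq hα]
  field_simp

lemma scale_mul_sub_eq {d n : ℕ} {α : ℝ} {l : Fin d → ℕ} (hl : Antitone l) {i k : Fin d}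
    (h : i < k) :
    √(α * d / n) * ((l i - l k : ℕ) : ℝ) = rescale d α n l i - rescale d α n l k := by
  rw [Nat.cast_sub (hl h.le), rescale, rescale]
  ring

lemma gammaTerm_parameters_pos {d : ℕ} {α : ℝ} (hα : 0 < α) (i : Fin d) :
    0 < ((d : ℝ) - 1 - i + 1) / α ∧ 0 < ((d : ℝ) - 1 - i) / α + 1 := by
  have := sub_one_sub_nonneg i
  constructor <;> positivity

lemma localWeight_nonneg {d n : ℕ} {α : ℝ} (hα : 0 < α) (hd : 0 < d) (hn : 0 < n)
    (l : Fin d → ℕ) : 0 ≤ localWeight d α n l := by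
  have hN : (0 : ℝ) < (n : ℝ) / d := by positivity
  refine mul_nonneg (Finset.prod_nonneg fun i _ => ?_)
    (Finset.prod_nonneg fun i _ => Finset.prod_nonneg fun k hk => ?_)
  · obtain ⟨h1, h2⟩ := gammaTerm_parameters_pos hα i
    exact mul_nonneg (gammaTerm_pos h1 hN _).le (gammaTerm_pos h2 hN _).le
  · simp only [Finset.mem_filter, Finset.mem_univ, true_and] at hk
    have := pairTerm_pos hα (one_le_sub_of_lt hk) (l i - l k)
    positivity

lemma tendsto_scale (d : ℕ) (α : ℝ) :
    Tendsto (fun n : ℕ => √(α * d / n)) atTop (𝓝 0) := by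
  simpa using (tendsto_const_div_atTop_nhds_zero_nat (α * d)).sqrt

lemma tendsto_localWeight {d : ℕ} {α : ℝ} (hα : 0 < α) (hd : 0 < d) {l : ℕ → Fin d → ℕ}
    {x : Fin d → ℝ} (hl : ∀ᶠ n in atTop, Antitone (l n)) (hx : ∀ i k, i < k → x k < x i)
    (hlx : ∀ i, Tendsto (fun n => rescale d α n (l n) i) atTop (𝓝 (x i))) :
    Tendsto (fun n => localWeight d α n (l n)) atTop (𝓝 (TracelessGBE.weight (2 / α) x)) := by
  have hd' : (0 : ℝ) < d := by exact_mod_cast hd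
  have hN : Tendsto (fun n : ℕ => (n : ℝ) / d) atTop atTop :=
    tendsto_natCast_atTop_atTop.atTop_div_const hd'
  have hz : ∀ i, Tendsto (fun n => ((l n i : ℝ) - (n : ℝ) / d) / √((n : ℝ) / d)) atTop
      (𝓝 (x i / √α)) := fun i => by
    simp only [sub_div_sqrt_eq hα]
    exact (hlx i).div_const _
  have h1 : Tendsto (fun n : ℕ => ∏ i : Fin d,
      gammaTerm (((d : ℝ) - 1 - i + 1) / α) (n / d) (l n i) *
        gammaTerm (((d : ℝ) - 1 - i) / α + 1) (n / d) (l n i)) atTop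
      (𝓝 (∏ i : Fin d, exp (-((x i / √α) ^ 2 / 2)) * exp (-((x i / √α) ^ 2 / 2)))) := by
    refine tendsto_finsetProd _ fun i _ => ?_
    obtain ⟨p1, p2⟩ := gammaTerm_parameters_pos hα i
    exact (tendsto_gammaTerm p1 hN (hz i)).mul (tendsto_gammaTerm p2 hN (hz i))
  have h2 : Tendsto (fun n : ℕ => ∏ i : Fin d, ∏ k ∈ Finset.univ.filter (fun k : Fin d => i < k),
      (√(α * d / n) ^ (2 / α) * pairTerm α ((k : ℝ) - i) (l n i - l n k))) atTop
      (𝓝 (∏ i : Fin d, ∏ k ∈ Finset.univ.filter (fun k : Fin d => i < k),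
        (x i - x k) ^ (2 / α))) := by
    refine tendsto_finsetProd _ fun i _ => tendsto_finsetProd _ fun k hk => ?_
    simp only [Finset.mem_filter, Finset.mem_univ, true_and] at hk
    refine tendsto_pairTerm hα (one_le_sub_of_lt hk) (fun n => sqrt_nonneg _) (tendsto_scale d α)
      (sub_pos.2 (hx i k hk)) ?_
    refine ((hlx i).sub (hlx k)).congr' ?_
    filter_upwards [hl] with n hn
    exact (scale_mul_sub_eq hn hk).symm
  -- Both hook products contribute a Gaussian of variance `α`; together they give the exponent `-x²
  -- / α = -(β / 2) x²`.
  have h3 : ∏ i : Fin d, exp (-((x i / √α) ^ 2 / 2)) * exp (-((x i / √α) ^ 2 / 2))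
      = exp (-(2 / α / 2) * ∑ j, x j ^ 2) := by
    rw [Finset.mul_sum, exp_sum]
    refine Finset.prod_congr rfl fun i _ => ?_
    rw [← exp_add, div_pow, sq_sqrt hα.le]
    ring_nf
  have h := h1.mul h2
  rw [h3] at h
  exact h

lemma exists_localWeight_le {d : ℕ} {α : ℝ} (hα : 0 < α) (hd : 0 < d) :
    ∃ C : ℝ, 0 < C ∧ ∀ n : ℕ, 0 < n → ∀ l ∈ partitions d n,
      localWeight d α n l ≤ C * exp (-∑ i, |rescale d α n l i|) := by
  have hd1 : (1 : ℝ) ≤ d := by exact_mod_cast hd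
  have hd' : (0 : ℝ) < d := by linarith
  have hsα : 0 < √α := by positivity
  set p : ℝ := ∑ i : Fin d, ∑ k ∈ Finset.univ.filter (fun k : Fin d => i < k), (1 : ℝ) with hp
  -- `p` is the number of pairs, each costing at most `exp ((2 / α) ∑ |x i|)`. Two row factors of
  -- rate `M` offset this and leave `exp (-∑ |x i|)`; `√α` converts from `z` to `x`.
  set M : ℝ := √α * ((p * (2 / α) + 1) / 2) with hM
  choose C₁ hC₁ h₁ using fun i : Fin d =>
    exists_gammaTerm_le (gammaTerm_parameters_pos hα i).1 hd1 M
  choose C₂ hC₂ h₂ using fun i : Fin d =>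
    exists_gammaTerm_le (gammaTerm_parameters_pos hα i).2 hd1 M
  have hpair : ∀ i k : Fin d, ∃ C : ℝ, 0 < C ∧ (i < k → ∀ (s : ℝ) (m : ℕ), 0 ≤ s → s ≤ √(α * d) →
      s ^ (2 / α) * pairTerm α ((k : ℝ) - i) m ≤ C * exp (2 / α * (s * m))) := by
    intro i k
    by_cases hik : i < k
    · obtain ⟨C, hC, h⟩ := exists_pairTerm_le hα (one_le_sub_of_lt hik) (√(α * d))
      exact ⟨C, hC, fun _ => h⟩
    · exact ⟨1, one_pos, fun h => absurd h hik⟩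
  choose C₃ hC₃ h₃ using hpair
  refine ⟨(∏ i, C₁ i * C₂ i) *
    ∏ i : Fin d, ∏ k ∈ Finset.univ.filter (fun k : Fin d => i < k), C₃ i k,
    mul_pos (Finset.prod_pos fun i _ => mul_pos (hC₁ i) (hC₂ i))
      (Finset.prod_pos fun i _ => Finset.prod_pos fun k _ => hC₃ i k), fun n hn l hl => ?_⟩
  obtain ⟨hsum, hanti⟩ := mem_partitions.1 hl
  have hn1 : (1 : ℝ) ≤ n := by exact_mod_cast hn
  have hdN : (d : ℝ) * (n / d) = n := by field_simp
  have hN : (0 : ℝ) < (n : ℝ) / d := by positivity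
  set x := rescale d α n l with hx
  set T := ∑ i, |x i| with hT
  have e1 : ∏ i : Fin d, gammaTerm (((d : ℝ) - 1 - i + 1) / α) (n / d) (l i) *
      gammaTerm (((d : ℝ) - 1 - i) / α + 1) (n / d) (l i)
      ≤ (∏ i, C₁ i * C₂ i) * exp (-((p * (2 / α) + 1) * T)) := by
    rw [hT, Finset.mul_sum, ← Finset.sum_neg_distrib, exp_sum, ← Finset.prod_mul_distrib]
    have hpos := gammaTerm_parameters_pos (d := d) hα
    refine Finset.prod_le_prod (fun i _ => mul_nonneg (gammaTerm_pos (hpos i).1 hN _).le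
      (gammaTerm_pos (hpos i).2 hN _).le) fun i _ => ?_
    have hli : (l i : ℝ) ≤ d * (n / d) := by
      rw [hdN, ← hsum]
      exact_mod_cast Finset.single_le_sum (fun j _ => Nat.zero_le (l j)) (Finset.mem_univ i)
    have g1 := h₁ i (n / d) (l i) (by rwa [hdN]) hli
    have g2 := h₂ i (n / d) (l i) (by rwa [hdN]) hli
    have hMz : M * |((l i : ℝ) - (n : ℝ) / d) / √((n : ℝ) / d)| = (p * (2 / α) + 1) / 2 * |x i| := by
      rw [sub_div_sqrt_eq hα, ← hx, abs_div, abs_of_pos hsα, hM]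
      field_simp
    rw [hMz] at g1 g2
    calc _ ≤ (C₁ i * exp (-((p * (2 / α) + 1) / 2 * |x i|))) *
        (C₂ i * exp (-((p * (2 / α) + 1) / 2 * |x i|))) :=
          mul_le_mul g1 g2 (gammaTerm_pos (hpos i).2 hN _).le
            (mul_nonneg (hC₁ i).le (exp_pos _).le)
      _ = C₁ i * C₂ i * (exp (-((p * (2 / α) + 1) / 2 * |x i|)) *
        exp (-((p * (2 / α) + 1) / 2 * |x i|))) := by ring
      _ = _ := by
        rw [← exp_add]
        ring_nf
  have e2 : ∏ i : Fin d, ∏ k ∈ Finset.univ.filter (fun k : Fin d => i < k),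
      (√(α * d / n) ^ (2 / α) * pairTerm α ((k : ℝ) - i) (l i - l k))
      ≤ (∏ i : Fin d, ∏ k ∈ Finset.univ.filter (fun k : Fin d => i < k), C₃ i k) *
        exp (p * (2 / α * T)) := by
    have hexp : exp (p * (2 / α * T)) = ∏ i : Fin d,
        ∏ k ∈ Finset.univ.filter (fun k : Fin d => i < k), exp (2 / α * T) := by
      simp only [hp, Finset.sum_mul, one_mul, exp_sum]
    rw [hexp]
    simp only [← Finset.prod_mul_distrib]
    have hnn : ∀ i : Fin d, ∀ k ∈ Finset.univ.filter (fun k : Fin d => i < k),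
        0 ≤ √(α * d / n) ^ (2 / α) * pairTerm α ((k : ℝ) - i) (l i - l k) := fun i k hk => by
      simp only [Finset.mem_filter, Finset.mem_univ, true_and] at hk
      have := pairTerm_pos hα (one_le_sub_of_lt hk) (l i - l k)
      positivity
    refine Finset.prod_le_prod (fun i _ => Finset.prod_nonneg (hnn i)) fun i _ =>
      Finset.prod_le_prod (hnn i) fun k hk => ?_
    simp only [Finset.mem_filter, Finset.mem_univ, true_and] at hk
    have hs : √(α * d / n) ≤ √(α * d) := sqrt_le_sqrt (div_le_self (by positivity) hn1)
    refine (h₃ i k hk _ (l i - l k) (sqrt_nonneg _) hs).trans ?_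
    rw [scale_mul_sub_eq hanti hk]
    have hik : x i - x k ≤ T := by
      calc x i - x k ≤ |x i| + |x k| := by
            linarith [le_abs_self (x i), neg_abs_le (x k)]
        _ = ∑ j ∈ {i, k}, |x j| := (Finset.sum_pair (f := fun j => |x j|) hk.ne).symm
        _ ≤ T := Finset.sum_le_univ_sum_of_nonneg fun j => abs_nonneg _
    have := (hC₃ i k).le
    gcongr
  calc localWeight d α n l ≤ ((∏ i, C₁ i * C₂ i) * exp (-((p * (2 / α) + 1) * T))) *
        ((∏ i : Fin d, ∏ k ∈ Finset.univ.filter (fun k : Fin d => i < k), C₃ i k) *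
        exp (p * (2 / α * T))) := by
        refine mul_le_mul e1 e2 (Finset.prod_nonneg fun i _ => Finset.prod_nonneg fun k hk => ?_)
          (mul_nonneg (Finset.prod_nonneg fun i _ => (mul_pos (hC₁ i) (hC₂ i)).le) (exp_pos _).le)
        simp only [Finset.mem_filter, Finset.mem_univ, true_and] at hk
        have := pairTerm_pos hα (one_le_sub_of_lt hk) (l i - l k)
        positivity
    _ = _ := by
        rw [mul_mul_mul_comm, ← exp_add]
        ring_nf

end JackMeasure

namespace TracelessGBE

open Real Topology

/-! ### The traceless ensemble in the first `d - 1` coordinates -/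

lemma lift_castSucc {m : ℕ} (y : Fin m → ℝ) (i : Fin m) : lift (m + 1) y i.castSucc = y i := by
  simp [lift]

lemma lift_last {m : ℕ} (y : Fin m → ℝ) : lift (m + 1) y (Fin.last m) = -∑ k, y k := by
  simp [lift]

lemma continuous_lift (m : ℕ) : Continuous (lift (m + 1)) := by
  refine continuous_pi fun i => ?_
  induction i using Fin.lastCases with
  | last => simp only [lift_last]; fun_prop
  | cast i => simp only [lift_castSucc]; fun_prop

lemma measurableSet_chamber (m : ℕ) : MeasurableSet (chamber (m + 1)) := by
  have h := continuous_lift m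
  refine IsClosed.measurableSet ?_
  simp only [chamber, Set.ofPred_forall]
  exact isClosed_iInter fun i => isClosed_iInter fun j => isClosed_iInter fun _ =>
    isClosed_le ((continuous_apply j).comp h) ((continuous_apply i).comp h)

lemma measurable_weight_lift (m : ℕ) (β : ℝ) :
    Measurable fun y : Fin m → ℝ => weight β (lift (m + 1) y) := by
  have h : ∀ i, Measurable fun y : Fin m → ℝ => lift (m + 1) y i := fun i =>
    ((continuous_apply i).comp (continuous_lift m)).measurable
  unfold weight
  refine Measurable.mul ?_ ?_
  · exact ((Finset.measurable_sum _ fun j _ => (h j).pow_const 2).const_mul _).exp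
  · exact Finset.measurable_prod _ fun j _ => Finset.measurable_prod _ fun k _ =>
      ((h j).sub (h k)).pow_const β

lemma weight_nonneg {d : ℕ} (β : ℝ) {x : Fin d → ℝ} (hx : Antitone x) : 0 ≤ weight β x := by
  refine mul_nonneg (exp_pos _).le (Finset.prod_nonneg fun j _ => Finset.prod_nonneg fun k hk => ?_)
  simp only [Finset.mem_filter, Finset.mem_univ, true_and] at hk
  exact rpow_nonneg (sub_nonneg.2 (hx hk.le)) _

lemma weight_pos {d : ℕ} (β : ℝ) {x : Fin d → ℝ} (hx : StrictAnti x) : 0 < weight β x := by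
  refine mul_pos (exp_pos _) (Finset.prod_pos fun j _ => Finset.prod_pos fun k hk => ?_)
  simp only [Finset.mem_filter, Finset.mem_univ, true_and] at hk
  exact rpow_pos_of_pos (sub_pos.2 (hx hk)) _

lemma mem_chamber {d : ℕ} {y : Fin (d - 1) → ℝ} : y ∈ chamber d ↔ Antitone (lift d y) := by
  simp [chamber, Antitone]

/-- The difference of two coordinates of `lift`, as a linear functional. -/
def liftDiff {m : ℕ} (i j : Fin (m + 1)) : (Fin m → ℝ) →ₗ[ℝ] ℝ where
  toFun y := lift (m + 1) y i - lift (m + 1) y j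
  map_add' y z := by
    have : ∀ k, lift (m + 1) (y + z) k = lift (m + 1) y k + lift (m + 1) z k := fun k => by
      induction k using Fin.lastCases with
      | last => simp only [lift_last, Pi.add_apply, Finset.sum_add_distrib]; ring
      | cast k => simp [lift_castSucc]
    rw [this, this]
    ring
  map_smul' c y := by
    have : ∀ k, lift (m + 1) (c • y) k = c * lift (m + 1) y k := fun k => by
      induction k using Fin.lastCases with
      | last => simp only [lift_last, Pi.smul_apply, smul_eq_mul, ← Finset.mul_sum]; ring
      | cast k => simp [lift_castSucc]
    rw [this, this]
    simp
    ring

/-- A wall of the chamber is the kernel of a nonzero functional, hence null. The functional is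
nonzero at the `i`-th basis vector, with value 2 if `j` is last and 1 otherwise. -/
lemma ae_lift_ne {m : ℕ} {i j : Fin (m + 1)} (hij : i < j) :
    ∀ᵐ y : Fin m → ℝ, lift (m + 1) y i ≠ lift (m + 1) y j := by
  have hker : LinearMap.ker (liftDiff i j) ≠ ⊤ := by
    intro h
    rw [LinearMap.ker_eq_top] at h
    obtain ⟨i, rfl⟩ : ∃ i' : Fin m, i = i'.castSucc :=
      ⟨i.castPred (hij.trans_le (Fin.le_last j)).ne, by simp⟩
    have h1 := LinearMap.congr_fun h (Pi.single i 1)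
    simp only [liftDiff, LinearMap.coe_mk, AddHom.coe_mk, LinearMap.zero_apply, lift_castSucc,
      Pi.single_eq_same] at h1
    induction j using Fin.lastCases with
    | last =>
      rw [lift_last, Finset.sum_pi_single'] at h1
      norm_num at h1
    | cast j =>
      have : j ≠ i := fun h => hij.ne (by rw [h])
      rw [lift_castSucc, Pi.single_eq_of_ne this] at h1
      norm_num at h1
  have h := Measure.addHaar_submodule (volume : Measure (Fin m → ℝ)) _ hker
  rw [ae_iff]
  convert h using 2
  ext y
  simp [liftDiff, sub_eq_zero]

lemma ae_strictAnti_or_notMem_chamber (m : ℕ) :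
    ∀ᵐ y : Fin m → ℝ, StrictAnti (lift (m + 1) y) ∨ y ∉ chamber (m + 1) := by
  have h : ∀ᵐ y : Fin m → ℝ, ∀ i j : Fin (m + 1), i < j →
      lift (m + 1) y i ≠ lift (m + 1) y j := by
    simp only [ae_all_iff]
    exact fun i j hij => ae_lift_ne hij
  filter_upwards [h] with y hy
  by_cases hc : y ∈ chamber (m + 1)
  · left
    have := mem_chamber.1 hc
    exact fun i j hij => (this hij.le).lt_of_ne (hy i j hij).symm
  · exact Or.inr hc

lemma exists_strictAnti_lift (m : ℕ) : ∃ y : Fin m → ℝ, StrictAnti (lift (m + 1) y) := by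
  have hsum : ∀ k : ℕ, ∑ i : Fin k, (((k : ℝ) - 1) / 2 - (i : ℕ)) = 0 := fun k => by
    rw [Finset.sum_sub_distrib, Fin.sum_univ_eq_sum_range (fun i => (i : ℝ)),
      ← Nat.cast_sum, Finset.sum_range_id, Nat.cast_div_charZero (Nat.even_mul_pred_self k).two_dvd]
    rcases k with _ | k
    · simp
    · simp
      ring
  -- The centred staircase: its sum over all `m + 1` indices vanishes, so the lifted last coordinate
  -- continues it.
  refine ⟨fun i => (m : ℝ) / 2 - (i : ℕ), ?_⟩
  have h : lift (m + 1) (fun i : Fin m => (m : ℝ) / 2 - (i : ℕ))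
      = fun i : Fin (m + 1) => (m : ℝ) / 2 - (i : ℕ) := by
    funext i
    induction i using Fin.lastCases with
    | last =>
      have := hsum (m + 1)
      rw [Fin.sum_univ_castSucc] at this
      simp only [Nat.cast_add, Nat.cast_one, add_sub_cancel_right, Fin.val_castSucc,
        Fin.val_last] at this
      rw [lift_last, Fin.val_last]
      linarith
    | cast i => rw [lift_castSucc, Fin.val_castSucc]
  rw [h]
  intro i j hij
  have : ((i : ℕ) : ℝ) < (j : ℕ) := by exact_mod_cast hij
  simp only
  linarith

lemma isOpen_strictAnti_lift (m : ℕ) :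
    IsOpen {y : Fin m → ℝ | StrictAnti (lift (m + 1) y)} := by
  have h := continuous_lift m
  have : {y : Fin m → ℝ | StrictAnti (lift (m + 1) y)} = ⋂ i, ⋂ j, ⋂ (_ : i < j),
      {y : Fin m → ℝ | lift (m + 1) y j < lift (m + 1) y i} := by
    ext y
    simp [StrictAnti]
  rw [this]
  exact isOpen_iInter_of_finite fun i => isOpen_iInter_of_finite fun j =>
    isOpen_iInter_of_finite fun _ =>
      isOpen_lt ((continuous_apply j).comp h) ((continuous_apply i).comp h)

end TracelessGBE

namespace JackMeasure

open Real Topology TracelessGBE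

/-! ### The sum over partitions as the integral of a step function -/

/-- The mesh of the lattice of rescaled partitions. -/
def mesh (d : ℕ) (α : ℝ) (n : ℕ) : ℝ := √(α * d / n)

lemma mesh_pos {d n : ℕ} {α : ℝ} (hα : 0 < α) (hd : 0 < d) (hn : 0 < n) : 0 < mesh d α n := by
  unfold mesh
  positivity

lemma mesh_le {d n : ℕ} {α : ℝ} (hα : 0 < α) (hn : 0 < n) : mesh d α n ≤ √(α * d) :=
  sqrt_le_sqrt (div_le_self (by positivity) (by exact_mod_cast hn))

lemma tendsto_mesh_mul (d : ℕ) (α c : ℝ) : Tendsto (fun n => c * mesh d α n) atTop (𝓝 0) := by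
  have h := (tendsto_scale d α).const_mul c
  rwa [mul_zero] at h

/-- The cell of the lattice of rescaled partitions attached to `l`. -/
def cell {m : ℕ} (α : ℝ) (n : ℕ) (l : Fin (m + 1) → ℕ) : Set (Fin m → ℝ) :=
  Set.pi Set.univ fun i => Set.Ico (rescale (m + 1) α n l i.castSucc)
    (rescale (m + 1) α n l i.castSucc + mesh (m + 1) α n)

lemma mem_cell {m : ℕ} {α : ℝ} {n : ℕ} {l : Fin (m + 1) → ℕ} {y : Fin m → ℝ} :
    y ∈ cell α n l ↔ ∀ i : Fin m, rescale (m + 1) α n l i.castSucc ≤ y i ∧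
      y i < rescale (m + 1) α n l i.castSucc + mesh (m + 1) α n := by
  simp [cell, Set.mem_pi]

lemma measurableSet_cell {m : ℕ} (α : ℝ) (n : ℕ) (l : Fin (m + 1) → ℕ) :
    MeasurableSet (cell α n l) :=
  MeasurableSet.univ_pi fun _ => measurableSet_Ico

lemma volume_cell {m : ℕ} (α : ℝ) (n : ℕ) (l : Fin (m + 1) → ℕ) :
    volume (cell α n l) = ENNReal.ofReal (mesh (m + 1) α n) ^ m := by
  rw [cell, Real.volume_pi_Ico]
  simp

/-- The first `m` coordinates err by at most `s`; the last, being minus their sum, by at most `m s`.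
Real `k` covers both partitions and integer lattice points. -/
lemma abs_scale_sub_lift_le {m n : ℕ} {s : ℝ} (hs : 0 ≤ s) {k : Fin (m + 1) → ℝ}
    (hk : ∑ i, k i = n) {y : Fin m → ℝ}
    (hy : ∀ i : Fin m, s * (k i.castSucc - (n : ℝ) / (m + 1 : ℕ)) ≤ y i ∧
      y i ≤ s * (k i.castSucc - (n : ℝ) / (m + 1 : ℕ)) + s) (i : Fin (m + 1)) :
    |s * (k i - (n : ℝ) / (m + 1 : ℕ)) - lift (m + 1) y i| ≤ (m + 1) * s := by
  have hms : 0 ≤ m * s := by positivity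
  induction i using Fin.lastCases with
  | cast i =>
    rw [lift_castSucc, abs_le]
    constructor <;> linarith [hy i]
  | last =>
    have h0 : ∑ i : Fin m, s * (k i.castSucc - (n : ℝ) / (m + 1 : ℕ)) +
        s * (k (Fin.last m) - (n : ℝ) / (m + 1 : ℕ)) = 0 := by
      rw [← Fin.sum_univ_castSucc (fun i => s * (k i - (n : ℝ) / (m + 1 : ℕ))), ← Finset.mul_sum,
        Finset.sum_sub_distrib, hk]
      simp only [Finset.sum_const, Finset.card_univ, Fintype.card_fin, nsmul_eq_mul]
      have : ((m + 1 : ℕ) : ℝ) ≠ 0 := by positivity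
      field_simp
      simp
    have h1 : ∑ i : Fin m, s * (k i.castSucc - (n : ℝ) / (m + 1 : ℕ)) ≤ ∑ i, y i :=
      Finset.sum_le_sum fun i _ => (hy i).1
    have h2 : ∑ i, y i ≤ ∑ i : Fin m, s * (k i.castSucc - (n : ℝ) / (m + 1 : ℕ)) + m * s := by
      refine (Finset.sum_le_sum fun i _ => (hy i).2).trans ?_
      rw [Finset.sum_add_distrib]
      simp
    rw [lift_last, abs_le]
    constructor <;> linarith

lemma abs_rescale_sub_lift_le {m n : ℕ} {α : ℝ} {l : Fin (m + 1) → ℕ}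
    (hl : l ∈ partitions (m + 1) n) {y : Fin m → ℝ} (hy : y ∈ cell α n l) (i : Fin (m + 1)) :
    |rescale (m + 1) α n l i - lift (m + 1) y i| ≤ (m + 1) * mesh (m + 1) α n := by
  refine abs_scale_sub_lift_le (sqrt_nonneg _) (k := fun i => (l i : ℝ)) ?_ (fun i => ?_) i
  · exact_mod_cast (mem_partitions.1 hl).1
  · exact ⟨(mem_cell.1 hy i).1, (mem_cell.1 hy i).2.le⟩

/-- Half-open cubes on a lattice of the same mesh are disjoint, and the last part is fixed by the
total `n`. -/
lemma eq_of_mem_cell {m n : ℕ} {α : ℝ} {l l' : Fin (m + 1) → ℕ}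
    (hs : 0 < mesh (m + 1) α n) (hl : l ∈ partitions (m + 1) n) (hl' : l' ∈ partitions (m + 1) n)
    {y : Fin m → ℝ} (hy : y ∈ cell α n l) (hy' : y ∈ cell α n l') : l = l' := by
  have key : ∀ {l l' : Fin (m + 1) → ℕ}, y ∈ cell α n l → y ∈ cell α n l' → ∀ i : Fin m,
      l i.castSucc ≤ l' i.castSucc := by
    intro l l' h h' i
    have h1 : rescale (m + 1) α n l i.castSucc <
        rescale (m + 1) α n l' i.castSucc + mesh (m + 1) α n :=
      (mem_cell.1 h i).1.trans_lt (mem_cell.1 h' i).2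
    have h2 : mesh (m + 1) α n * (l i.castSucc : ℝ)
        < mesh (m + 1) α n * ((l' i.castSucc : ℝ) + 1) := by
      simp only [rescale] at h1
      unfold mesh at h1 ⊢
      linarith
    have h3 := lt_of_mul_lt_mul_left h2 hs.le
    have h4 : l i.castSucc < l' i.castSucc + 1 := by exact_mod_cast h3
    omega
  have hc : ∀ i : Fin m, l i.castSucc = l' i.castSucc := fun i =>
    le_antisymm (key hy hy' i) (key hy' hy i)
  have hsum := (mem_partitions.1 hl).1.trans (mem_partitions.1 hl').1.symm
  rw [Fin.sum_univ_castSucc, Fin.sum_univ_castSucc, Finset.sum_congr rfl fun i _ => hc i] at hsum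
  funext i
  induction i using Fin.lastCases with
  | last => omega
  | cast i => exact hc i

/-- The step function on the cells of the partitions of `n` with values `F`. -/
def stepFun {m : ℕ} (α : ℝ) (n : ℕ) (F : (Fin (m + 1) → ℕ) → ℝ) (y : Fin m → ℝ) : ℝ :=
  ∑ l ∈ partitions (m + 1) n, (cell α n l).indicator (fun _ => F l) y

lemma stepFun_eq_of_mem {m n : ℕ} {α : ℝ} {F : (Fin (m + 1) → ℕ) → ℝ} {l : Fin (m + 1) → ℕ}
    (hs : 0 < mesh (m + 1) α n) (hl : l ∈ partitions (m + 1) n) {y : Fin m → ℝ}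
    (hy : y ∈ cell α n l) : stepFun α n F y = F l := by
  rw [stepFun, Finset.sum_eq_single_of_mem l hl, Set.indicator_of_mem hy]
  intro l' hl' hne
  exact Set.indicator_of_notMem (fun h => hne (eq_of_mem_cell hs hl' hl h hy)) _

lemma stepFun_eq_zero {m n : ℕ} {α : ℝ} {F : (Fin (m + 1) → ℕ) → ℝ} {y : Fin m → ℝ}
    (hy : ∀ l ∈ partitions (m + 1) n, y ∉ cell α n l) : stepFun α n F y = 0 :=
  Finset.sum_eq_zero fun l hl => Set.indicator_of_notMem (hy l hl) _

lemma measurable_stepFun {m n : ℕ} {α : ℝ} {F : (Fin (m + 1) → ℕ) → ℝ} :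
    Measurable (stepFun (m := m) α n F) :=
  Finset.measurable_sum _ fun l _ => measurable_const.indicator (measurableSet_cell α n l)

lemma integral_stepFun {m n : ℕ} {α : ℝ} {F : (Fin (m + 1) → ℕ) → ℝ} :
    ∫ y, stepFun (m := m) α n F y =
      (∑ l ∈ partitions (m + 1) n, F l) * mesh (m + 1) α n ^ m := by
  unfold stepFun
  rw [integral_finsetSum, Finset.sum_mul]
  · refine Finset.sum_congr rfl fun l _ => ?_
    rw [integral_indicator_const _ (measurableSet_cell α n l), measureReal_def, volume_cell,
      ENNReal.toReal_pow,
      ENNReal.toReal_ofReal (show 0 ≤ mesh (m + 1) α n from sqrt_nonneg _), smul_eq_mul, mul_comm]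
  · intro l _
    rw [integrable_indicator_iff (measurableSet_cell α n l)]
    refine integrableOn_const ?_
    rw [volume_cell]
    finiteness

/-- The lattice point, with integer coordinates of sum `n`, whose cell contains `y`. -/
def latticePoint {m : ℕ} (α : ℝ) (n : ℕ) (y : Fin m → ℝ) : Fin (m + 1) → ℤ :=
  Fin.snoc (α := fun _ => ℤ) (fun i => ⌊y i / mesh (m + 1) α n + (n : ℝ) / (m + 1 : ℕ)⌋)
    ((n : ℤ) - ∑ i : Fin m, ⌊y i / mesh (m + 1) α n + (n : ℝ) / (m + 1 : ℕ)⌋)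

lemma sum_latticePoint {m : ℕ} (α : ℝ) (n : ℕ) (y : Fin m → ℝ) :
    ∑ i, latticePoint α n y i = n := by
  rw [Fin.sum_univ_castSucc]
  simp [latticePoint]

lemma latticePoint_mem {m n : ℕ} {α : ℝ} (hs : 0 < mesh (m + 1) α n) (y : Fin m → ℝ) (i : Fin m) :
    mesh (m + 1) α n * ((latticePoint α n y i.castSucc : ℝ) - (n : ℝ) / (m + 1 : ℕ)) ≤ y i ∧
    y i < mesh (m + 1) α n * ((latticePoint α n y i.castSucc : ℝ) - (n : ℝ) / (m + 1 : ℕ)) +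
      mesh (m + 1) α n := by
  have e : latticePoint α n y i.castSucc = ⌊y i / mesh (m + 1) α n + (n : ℝ) / (m + 1 : ℕ)⌋ := by
    simp [latticePoint]
  rw [e]
  set s := mesh (m + 1) α n
  set q := y i / s + (n : ℝ) / (m + 1 : ℕ) with hq
  have hyq : y i = s * (q - (n : ℝ) / (m + 1 : ℕ)) := by
    rw [hq]
    field_simp
    ring
  have h1 := Int.floor_le q
  have h2 := Int.lt_floor_add_one q
  constructor
  · calc _ ≤ s * (q - (n : ℝ) / (m + 1 : ℕ)) := by gcongr
      _ = y i := hyq.symm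
  · have := mul_lt_mul_of_pos_left h2 hs
    linarith

lemma abs_latticePoint_sub_lift_le {m n : ℕ} {α : ℝ} (hs : 0 < mesh (m + 1) α n) (y : Fin m → ℝ)
    (i : Fin (m + 1)) :
    |mesh (m + 1) α n * ((latticePoint α n y i : ℝ) - (n : ℝ) / (m + 1 : ℕ)) - lift (m + 1) y i| ≤
      (m + 1) * mesh (m + 1) α n := by
  refine abs_scale_sub_lift_le hs.le (k := fun i => (latticePoint α n y i : ℝ)) ?_ (fun i => ?_) i
  · exact_mod_cast sum_latticePoint α n y
  · exact ⟨(latticePoint_mem hs y i).1, (latticePoint_mem hs y i).2.le⟩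

lemma tendsto_mesh_mul_mean {d : ℕ} {α : ℝ} (hα : 0 < α) (hd : 0 < d) :
    Tendsto (fun n : ℕ => mesh d α n * ((n : ℝ) / d)) atTop atTop := by
  have hd' : (0 : ℝ) < d := by exact_mod_cast hd
  have h : Tendsto (fun n : ℕ => √α * √((n : ℝ) / d)) atTop atTop :=
    (tendsto_sqrt_atTop.comp
      (tendsto_natCast_atTop_atTop.atTop_div_const hd')).const_mul_atTop (by positivity)
  refine h.congr' ?_
  filter_upwards [eventually_gt_atTop 0] with n hn
  have hN : (0 : ℝ) < (n : ℝ) / d := by positivity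
  rw [mesh, sqrt_scale_eq hα]
  nth_rw 3 [← mul_self_sqrt hN.le]
  field_simp

/-- For `y` in the open chamber, the lattice point of `y` is eventually a partition. -/
lemma eventually_latticePoint_toNat_mem {m : ℕ} {α : ℝ} (hα : 0 < α) {y : Fin m → ℝ}
    (hy : StrictAnti (lift (m + 1) y)) :
    ∀ᶠ n in atTop, (fun i => (latticePoint α n y i).toNat) ∈ partitions (m + 1) n ∧
      y ∈ cell α n (fun i => (latticePoint α n y i).toNat) := by
  have hnn : ∀ᶠ n in atTop, ∀ i : Fin (m + 1), 0 ≤ latticePoint α n y i := by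
    rw [eventually_all]
    intro i
    -- The rescaled mean part is of order `√n`, so a fixed `y` cannot make a coordinate negative for
    -- large `n`.
    have h1 : Tendsto (fun n : ℕ => mesh (m + 1) α n * ((n : ℝ) / (m + 1 : ℕ)) +
        (lift (m + 1) y i - (m + 1) * mesh (m + 1) α n)) atTop atTop :=
      (tendsto_mesh_mul_mean hα m.succ_pos).atTop_add
        (tendsto_const_nhds.sub (tendsto_mesh_mul _ _ _))
    filter_upwards [h1.eventually_gt_atTop 0, eventually_gt_atTop 0] with n hn hn0
    have hs := mesh_pos (d := m + 1) hα m.succ_pos hn0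
    have h2 := (abs_le.1 (abs_latticePoint_sub_lift_le hs y i)).1
    have h3 : 0 < mesh (m + 1) α n * (latticePoint α n y i : ℝ) := by linarith
    have h4 : (0 : ℝ) < latticePoint α n y i := (mul_pos_iff_of_pos_left hs).1 h3
    exact_mod_cast h4.le
  have hanti : ∀ᶠ n in atTop, ∀ i j : Fin (m + 1), i < j →
      latticePoint α n y j ≤ latticePoint α n y i := by
    simp only [eventually_all]
    intro i j hij
    -- Two coordinates, each off by at most `(m + 1) * mesh`; the positive gap eventually exceeds
    -- the total error.
    have h1 := tendsto_mesh_mul (m + 1) α (2 * (m + 1))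
    filter_upwards [h1.eventually_lt_const (sub_pos.2 (hy hij)), eventually_gt_atTop 0]
      with n hn hn0
    have hs := mesh_pos (d := m + 1) hα m.succ_pos hn0
    have h2 := (abs_le.1 (abs_latticePoint_sub_lift_le hs y i)).1
    have h3 := (abs_le.1 (abs_latticePoint_sub_lift_le hs y j)).2
    have h4 : mesh (m + 1) α n * (latticePoint α n y j : ℝ)
        < mesh (m + 1) α n * (latticePoint α n y i : ℝ) := by linarith
    exact_mod_cast (lt_of_mul_lt_mul_left h4 hs.le).le
  filter_upwards [hnn, hanti, eventually_gt_atTop 0] with n h1 h2 hn0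
  have hs := mesh_pos (d := m + 1) hα m.succ_pos hn0
  have hcast : ∀ i, (((latticePoint α n y i).toNat : ℤ)) = latticePoint α n y i := fun i =>
    Int.toNat_of_nonneg (h1 i)
  refine ⟨mem_partitions.2 ⟨?_, ?_⟩, mem_cell.2 fun i => ?_⟩
  · have := sum_latticePoint α n y
    zify
    simp only [hcast, this]
  · intro i j hij
    rcases hij.eq_or_lt with rfl | hij
    · exact le_rfl
    · exact Int.toNat_le_toNat (h2 i j hij)
  · have h3 := latticePoint_mem hs y i
    have h4 : ((latticePoint α n y i.castSucc).toNat : ℝ) = latticePoint α n y i.castSucc := by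
      exact_mod_cast hcast i.castSucc
    simp only [rescale, h4]
    exact h3

lemma tendsto_rescale_latticePoint {m : ℕ} {α : ℝ} (hα : 0 < α) {y : Fin m → ℝ}
    (hy : StrictAnti (lift (m + 1) y)) :
    Tendsto (fun n => rescale (m + 1) α n (fun i => (latticePoint α n y i).toNat)) atTop
      (𝓝 (lift (m + 1) y)) := by
  rw [tendsto_pi_nhds]
  intro i
  rw [tendsto_iff_norm_sub_tendsto_zero]
  refine squeeze_zero' (Eventually.of_forall fun _ => norm_nonneg _) ?_
    (tendsto_mesh_mul (m + 1) α (m + 1))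
  filter_upwards [eventually_latticePoint_toNat_mem hα hy] with n hn
  exact abs_rescale_sub_lift_le hn.1 hn.2 i

lemma eventually_notMem_cell {m : ℕ} {α : ℝ} {y : Fin m → ℝ} (hy : y ∉ chamber (m + 1)) :
    ∀ᶠ n in atTop, ∀ l ∈ partitions (m + 1) n, y ∉ cell α n l := by
  rw [mem_chamber] at hy
  simp only [Antitone, not_forall, not_le] at hy
  obtain ⟨i, j, hij, hlt⟩ := hy
  have h1 := tendsto_mesh_mul (m + 1) α (2 * (m + 1))
  filter_upwards [h1.eventually_lt_const (sub_pos.2 hlt)] with n hn l hl hyl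
  have h2 := (abs_le.1 (abs_rescale_sub_lift_le hl hyl i)).2
  have h3 := (abs_le.1 (abs_rescale_sub_lift_le hl hyl j)).1
  have h4 : rescale (m + 1) α n l j ≤ rescale (m + 1) α n l i := by
    have : (l j : ℝ) ≤ l i := by exact_mod_cast (mem_partitions.1 hl).2 hij
    unfold rescale
    gcongr
  linarith

open scoped BoundedContinuousFunction

/-! ### Convergence of the rescaled sums -/

lemma integrable_exp_neg_sum_abs (m : ℕ) :
    Integrable fun y : Fin m → ℝ => exp (-∑ i, |y i|) := by
  have h1 : Integrable fun t : ℝ => exp (-|t|) := by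
    rw [← integrableOn_univ, ← Set.Iic_union_Ioi (a := (0 : ℝ))]
    refine IntegrableOn.union ?_ ?_
    · refine (integrableOn_exp_Iic 0).congr_fun (fun t ht => ?_) measurableSet_Iic
      simp [abs_of_nonpos (Set.mem_Iic.1 ht)]
    · refine (exp_neg_integrableOn_Ioi 0 one_pos).congr_fun (fun t ht => ?_) measurableSet_Ioi
      simp [abs_of_pos (Set.mem_Ioi.1 ht)]
  have h2 := Integrable.fintype_prod (ι := Fin m) (f := fun _ t => exp (-|t|)) fun _ => h1
  simp only [← Finset.sum_neg_distrib, exp_sum]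
  exact h2

lemma exists_stepFun_le {m : ℕ} {α : ℝ} (hα : 0 < α) :
    ∃ C : ℝ, 0 < C ∧ ∀ (f : (Fin (m + 1) → ℝ) →ᵇ ℝ) (n : ℕ), 0 < n → ∀ y : Fin m → ℝ,
      ‖stepFun α n (fun l => f (rescale (m + 1) α n l) * localWeight (m + 1) α n l) y‖ ≤
        ‖f‖ * (C * exp (-∑ i, |y i|)) := by
  obtain ⟨C, hC, hle⟩ := exists_localWeight_le (d := m + 1) hα m.succ_pos
  set S : ℝ := √(α * (m + 1 : ℕ)) with hS
  -- Within a cell each of the `m` coordinates moves by at most `mesh ≤ S`. The last rescaled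
  -- coordinate is dropped, as it only improves the bound.
  refine ⟨C * exp (m * S), by positivity, fun f n hn y => ?_⟩
  have hs := mesh_pos (d := m + 1) hα m.succ_pos hn
  by_cases h : ∃ l ∈ partitions (m + 1) n, y ∈ cell α n l
  · obtain ⟨l, hl, hy⟩ := h
    rw [stepFun_eq_of_mem hs hl hy, norm_mul]
    refine mul_le_mul (f.norm_coe_le_norm _) ?_ (norm_nonneg _) (norm_nonneg _)
    rw [norm_of_nonneg (localWeight_nonneg hα m.succ_pos hn l)]
    refine (hle n hn l hl).trans ?_
    rw [mul_assoc, ← exp_add]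
    refine mul_le_mul_of_nonneg_left (exp_le_exp.2 ?_) hC.le
    have h1 : ∑ i : Fin m, |y i| ≤ ∑ i : Fin m, (|rescale (m + 1) α n l i.castSucc| + S) := by
      refine Finset.sum_le_sum fun i _ => ?_
      have h2 := mem_cell.1 hy i
      have h3 := mesh_le (d := m + 1) hα hn
      have h4 : |y i - rescale (m + 1) α n l i.castSucc| ≤ S := by
        rw [abs_le]
        constructor <;> linarith
      linarith [abs_sub_abs_le_abs_sub (y i) (rescale (m + 1) α n l i.castSucc)]
    rw [Finset.sum_add_distrib] at h1
    simp only [Finset.sum_const, Finset.card_univ, Fintype.card_fin, nsmul_eq_mul] at h1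
    rw [Fin.sum_univ_castSucc]
    linarith [abs_nonneg (rescale (m + 1) α n l (Fin.last m))]
  · push Not at h
    rw [stepFun_eq_zero h, norm_zero]
    positivity

/-- In the open chamber exactly one cell contributes for large `n`, outside the closed chamber none
does, and the walls are null. -/
lemma ae_tendsto_stepFun {m : ℕ} {α : ℝ} (hα : 0 < α) (f : (Fin (m + 1) → ℝ) →ᵇ ℝ) :
    ∀ᵐ y : Fin m → ℝ, Tendsto (fun n => stepFun α n
      (fun l => f (rescale (m + 1) α n l) * localWeight (m + 1) α n l) y) atTop
      (𝓝 ((chamber (m + 1)).indicator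
        (fun y => f (lift (m + 1) y) * weight (2 / α) (lift (m + 1) y)) y)) := by
  filter_upwards [ae_strictAnti_or_notMem_chamber m] with y hy
  rcases hy with hy | hy
  · rw [Set.indicator_of_mem (mem_chamber.2 hy.antitone)]
    have hev := eventually_latticePoint_toNat_mem hα hy
    have hres := tendsto_rescale_latticePoint hα hy
    have h1 := (f.continuous.tendsto _).comp hres
    have h2 := tendsto_localWeight hα m.succ_pos (x := lift (m + 1) y)
      (hev.mono fun n hn => (mem_partitions.1 hn.1).2) (fun i k hik => hy hik)
      (tendsto_pi_nhds.1 hres)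
    refine (h1.mul h2).congr' ?_
    filter_upwards [hev, eventually_gt_atTop 0] with n hn hn0
    rw [stepFun_eq_of_mem (mesh_pos hα m.succ_pos hn0) hn.1 hn.2]
    rfl
  · rw [Set.indicator_of_notMem hy]
    refine tendsto_const_nhds.congr' ?_
    filter_upwards [eventually_notMem_cell (α := α) hy] with n hn
    exact (stepFun_eq_zero hn).symm

lemma tendsto_sum_localWeight {m : ℕ} {α : ℝ} (hα : 0 < α) (f : (Fin (m + 1) → ℝ) →ᵇ ℝ) :
    Tendsto (fun n => (∑ l ∈ partitions (m + 1) n,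
      f (rescale (m + 1) α n l) * localWeight (m + 1) α n l) * mesh (m + 1) α n ^ m) atTop
      (𝓝 (∫ y in chamber (m + 1), f (lift (m + 1) y) * weight (2 / α) (lift (m + 1) y))) := by
  obtain ⟨C, hC, hle⟩ := exists_stepFun_le (m := m) hα
  rw [← integral_indicator (measurableSet_chamber m)]
  simp only [← integral_stepFun]
  refine tendsto_integral_filter_of_dominated_convergence
    (fun y => ‖f‖ * (C * exp (-∑ i, |y i|))) (Eventually.of_forall fun n =>
      measurable_stepFun.aestronglyMeasurable) ?_
    (((integrable_exp_neg_sum_abs m).const_mul C).const_mul ‖f‖) (ae_tendsto_stepFun hα f)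
  filter_upwards [eventually_gt_atTop 0] with n hn
  exact ae_of_all _ (hle f n hn)

/-- As an almost everywhere limit of the step functions for `f = 1`, the density inherits their
integrable majorant. -/
lemma integrableOn_weight {m : ℕ} {α : ℝ} (hα : 0 < α) :
    IntegrableOn (fun y : Fin m → ℝ => weight (2 / α) (lift (m + 1) y)) (chamber (m + 1)) := by
  obtain ⟨C, hC, hle⟩ := exists_stepFun_le (m := m) hα
  rw [← integrable_indicator_iff (measurableSet_chamber m)]
  set f : (Fin (m + 1) → ℝ) →ᵇ ℝ := BoundedContinuousFunction.const _ 1 with hf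
  refine (((integrable_exp_neg_sum_abs m).const_mul C).const_mul ‖f‖).mono'
    ((measurable_weight_lift m _).indicator (measurableSet_chamber m)).aestronglyMeasurable ?_
  filter_upwards [ae_tendsto_stepFun hα f] with y hy
  simp only [hf, BoundedContinuousFunction.const_apply, one_mul] at hy
  refine le_of_tendsto hy.norm ?_
  filter_upwards [eventually_gt_atTop 0] with n hn
  simpa [hf] using hle f n hn y

lemma integral_weight_pos {m : ℕ} {α : ℝ} (hα : 0 < α) :
    0 < ∫ y in chamber (m + 1), weight (2 / α) (lift (m + 1) y) := by
  have hnn : 0 ≤ᵐ[volume.restrict (chamber (m + 1))]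
      fun y : Fin m → ℝ => weight (2 / α) (lift (m + 1) y) := by
    filter_upwards [ae_restrict_mem (measurableSet_chamber m)] with y hy
    exact weight_nonneg _ (mem_chamber.1 hy)
  rw [setIntegral_pos_iff_support_of_nonneg_ae hnn (integrableOn_weight hα)]
  refine ((isOpen_strictAnti_lift m).measure_pos volume (exists_strictAnti_lift m)).trans_le
    (measure_mono fun y hy => ⟨?_, mem_chamber.2 (StrictAnti.antitone hy)⟩)
  exact (weight_pos _ hy).ne'

end JackMeasure

namespace TracelessGBE

open Real Topology JackMeasure
open scoped BoundedContinuousFunction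

/-! ### The law of the traceless ensemble -/

lemma partitionFunction_eq {m : ℕ} {α : ℝ} (hα : 0 < α) :
    partitionFunction (m + 1) (2 / α) =
      ENNReal.ofReal (∫ y in chamber (m + 1), weight (2 / α) (lift (m + 1) y)) := by
  refine (ofReal_integral_eq_lintegral_ofReal (integrableOn_weight hα) ?_).symm
  filter_upwards [ae_restrict_mem (measurableSet_chamber m)] with y hy
  exact weight_nonneg _ (mem_chamber.1 hy)

lemma isProbabilityMeasure_law {m : ℕ} {α : ℝ} (hα : 0 < α) :
    IsProbabilityMeasure (law (m + 1) (2 / α)) := by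
  have hpos := integral_weight_pos (m := m) hα
  have hZ := partitionFunction_eq (m := m) hα
  have hZ0 : partitionFunction (m + 1) (2 / α) ≠ 0 := by
    rw [hZ]
    simpa using hpos
  have hZt : partitionFunction (m + 1) (2 / α) ≠ ⊤ := by simp [hZ]
  constructor
  rw [law, Measure.map_apply (continuous_lift m).measurable MeasurableSet.univ, Set.preimage_univ,
    withDensity_apply _ MeasurableSet.univ, Measure.restrict_univ, lintegral_const_mul]
  · exact ENNReal.inv_mul_cancel hZ0 hZt
  · exact (measurable_weight_lift m _).ennreal_ofReal

lemma integral_law {m : ℕ} {α : ℝ} (hα : 0 < α) (f : (Fin (m + 1) → ℝ) →ᵇ ℝ) :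
    ∫ x, f x ∂law (m + 1) (2 / α) =
      (∫ y in chamber (m + 1), f (lift (m + 1) y) * weight (2 / α) (lift (m + 1) y)) /
        ∫ y in chamber (m + 1), weight (2 / α) (lift (m + 1) y) := by
  have hpos := integral_weight_pos (m := m) hα
  have hZ := partitionFunction_eq (m := m) hα
  have hZ0 : partitionFunction (m + 1) (2 / α) ≠ 0 := by
    rw [hZ]
    simpa using hpos
  rw [law, integral_map (continuous_lift m).measurable.aemeasurable
    f.continuous.measurable.aestronglyMeasurable,
    integral_withDensity_eq_integral_toReal_smul]
  · rw [← integral_div]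
    refine setIntegral_congr_fun (measurableSet_chamber m) fun y hy => ?_
    rw [ENNReal.toReal_mul, ENNReal.toReal_ofReal (weight_nonneg _ (mem_chamber.1 hy)),
      ENNReal.toReal_inv, hZ, ENNReal.toReal_ofReal hpos.le, smul_eq_mul]
    ring
  · exact (measurable_weight_lift m _).ennreal_ofReal.const_mul _
  · exact ae_of_all _ fun y => ENNReal.mul_lt_top (by simpa [pos_iff_ne_zero] using hZ0)
      ENNReal.ofReal_lt_top

end TracelessGBE

namespace JackMeasure

open Real Topology TracelessGBE
open scoped BoundedContinuousFunction

/-! ### The restricted Jack measure -/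

lemma partitions_nonempty {d : ℕ} (hd : 0 < d) (n : ℕ) : (partitions d n).Nonempty := by
  obtain ⟨m, rfl⟩ : ∃ m, d = m + 1 := ⟨d - 1, by omega⟩
  refine ⟨Pi.single 0 n, mem_partitions.2 ⟨by simp, fun i j hij => ?_⟩⟩
  rcases eq_or_ne j 0 with rfl | hj
  · rw [Fin.le_zero_iff.1 hij]
  · simp [Pi.single_eq_of_ne hj]

lemma inv_hooks_pos {d n : ℕ} {α : ℝ} (hα : 0 < α) {l : Fin d → ℕ} (hl : l ∈ partitions d n) :
    0 < 1 / (hookLower α l * hookUpper α l) := by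
  have h := (mem_partitions.1 hl).2
  exact one_div_pos.2 (mul_pos (hookProd_pos hα one_pos h) (hookProd_pos hα hα h))

lemma normConst_pos {d : ℕ} {α : ℝ} (hα : 0 < α) (hd : 0 < d) (n : ℕ) : 0 < normConst d α n :=
  Finset.sum_pos (fun _ hl => inv_hooks_pos hα hl) (partitions_nonempty hd n)

lemma prob_nonneg {d n : ℕ} {α : ℝ} (hα : 0 < α) (hd : 0 < d) {l : Fin d → ℕ}
    (hl : l ∈ partitions d n) : 0 ≤ prob d α n l :=
  mul_nonneg (one_div_pos.2 (normConst_pos hα hd n)).le (inv_hooks_pos hα hl).le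

lemma isProbabilityMeasure_restricted {d : ℕ} {α : ℝ} (hα : 0 < α) (hd : 0 < d) (n : ℕ) :
    IsProbabilityMeasure (restricted d α n) := by
  constructor
  simp only [restricted, Measure.finsetSum_apply, Measure.smul_apply, measure_univ, smul_eq_mul,
    mul_one]
  rw [← ENNReal.ofReal_sum_of_nonneg fun l hl => prob_nonneg hα hd hl]
  simp only [prob]
  rw [← Finset.mul_sum, ← normConst, one_div_mul_cancel (normConst_pos hα hd n).ne',
    ENNReal.ofReal_one]

lemma integral_restricted {d n : ℕ} {α : ℝ} (hα : 0 < α) (hd : 0 < d) (g : (Fin d → ℕ) → ℝ) :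
    ∫ l, g l ∂restricted d α n = ∑ l ∈ partitions d n, prob d α n l * g l := by
  rw [restricted, integral_finsetSum_measure]
  · refine Finset.sum_congr rfl fun l hl => ?_
    rw [integral_smul_measure, integral_dirac, ENNReal.toReal_ofReal (prob_nonneg hα hd hl),
      smul_eq_mul]
  · intro l _
    exact (integrable_dirac (by simp)).smul_measure ENNReal.ofReal_ne_top

lemma integral_restricted_eq_div {d n : ℕ} {α : ℝ} (hα : 0 < α) (hd : 0 < d) (hn : 0 < n)
    (g : (Fin d → ℕ) → ℝ) :
    ∫ l, g l ∂restricted d α n = (∑ l ∈ partitions d n, g l * localWeight d α n l) /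
      ∑ l ∈ partitions d n, localWeight d α n l := by
  obtain ⟨K, hK, h⟩ := exists_localWeight_eq hα hd hn
  have h1 : ∑ l ∈ partitions d n, localWeight d α n l = K * normConst d α n := by
    rw [normConst, Finset.mul_sum]
    exact Finset.sum_congr rfl h
  have hN := normConst_pos hα hd n
  rw [integral_restricted hα hd, h1, Finset.sum_div]
  refine Finset.sum_congr rfl fun l hl => ?_
  rw [h l hl, prob]
  field_simp

/-- Quotient of the limits for `f` and for the constant 1; the cell volume `mesh ^ m` cancels. -/
lemma tendsto_integral_rescale {m : ℕ} {α : ℝ} (hα : 0 < α) (f : (Fin (m + 1) → ℝ) →ᵇ ℝ) :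
    Tendsto (fun n => ∫ l, f (rescale (m + 1) α n l) ∂restricted (m + 1) α n) atTop
      (𝓝 (∫ x, f x ∂law (m + 1) (2 / α))) := by
  rw [integral_law hα]
  have h1 := tendsto_sum_localWeight hα f
  have h2 := tendsto_sum_localWeight (m := m) hα (BoundedContinuousFunction.const _ 1)
  simp only [BoundedContinuousFunction.const_apply, one_mul] at h2
  refine (h1.div h2 (integral_weight_pos hα).ne').congr' ?_
  filter_upwards [eventually_gt_atTop 0] with n hn
  have hs := mesh_pos (d := m + 1) hα m.succ_pos hn
  rw [integral_restricted_eq_div hα m.succ_pos hn, Pi.div_apply,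
    mul_div_mul_right _ _ (by positivity)]

end JackMeasure

end

/-! ### Convergence in distribution -/

theorem theorem1 (d : ℕ) (hd : 0 < d) (α β : ℝ) (hα : 0 < α) (hβ : β = 2 / α) :
    (∀ n : ℕ, IsProbabilityMeasure (JackMeasure.restricted d α n)) ∧
    IsProbabilityMeasure (TracelessGBE.law d β) ∧
    ∀ (Ω : ℕ → Type*) [∀ n, MeasurableSpace (Ω n)]
      (P : ∀ n, Measure (Ω n)) [∀ n, IsProbabilityMeasure (P n)]
      (L : ∀ n, Ω n → Fin d → ℕ)
      (Ω' : Type*) [MeasurableSpace Ω'] (Q : Measure Ω') [IsProbabilityMeasure Q]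
      (X : Ω' → Fin d → ℝ),
      (∀ n, HasLaw (L n) (JackMeasure.restricted d α n) (P n)) →
      HasLaw X (TracelessGBE.law d β) Q →
      TendstoInDistribution (fun n ω => JackMeasure.rescale d α n (L n ω)) atTop X P Q := by
  subst hβ
  obtain ⟨m, rfl⟩ : ∃ m, d = m + 1 := ⟨d - 1, by omega⟩
  refine ⟨JackMeasure.isProbabilityMeasure_restricted hα hd,
    TracelessGBE.isProbabilityMeasure_law hα, ?_⟩
  intro Ω _ P _ L Ω' _ Q _ X hL hX
  have hmeas : ∀ n, Measurable (JackMeasure.rescale (m + 1) α n) := fun n =>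
    measurable_of_countable _
  have hmeasL : ∀ n, AEMeasurable (fun ω => JackMeasure.rescale (m + 1) α n (L n ω)) (P n) :=
    fun n => (hmeas n).comp_aemeasurable (hL n).aemeasurable
  refine ⟨hmeasL, hX.aemeasurable, ?_⟩
  refine ProbabilityMeasure.tendsto_iff_forall_integral_tendsto.2 fun f => ?_
  have h := JackMeasure.tendsto_integral_rescale hα f
  simp only [ProbabilityMeasure.coe_mk]
  rw [hX.map_eq]
  refine h.congr fun n => ?_
  rw [integral_map (hmeasL n) f.continuous.measurable.aestronglyMeasurable, ← (hL n).map_eq]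
  exact integral_map (hL n).aemeasurable
    (f.continuous.measurable.comp (hmeas n)).aestronglyMeasurable
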